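/- Let $\mathbb F_q$ be a finite field, $K\ge 1$ and $0\le\delta<1$. Consider the $K$-user symmetric erasure broadcast channel with state feedback: in each slot the transmitter sends one symbol (packet) of $\mathbb F_q$, each user receives it with probability $1-\delta$ and an erasure otherwise, independently across users and slots; the symbol sent in slot $l$ is a function of the messages and of the channel states of the slots before $l$, where the state of a slot is the set of users that received its packet, and every user knows all the states. For $1\le j\le K$, the order-$j$ messages are independent messages $W_{\mathcal J}$, one for each $\mathcal J\subseteq\{1,\dots,K\}$ with $|\mathcal J|=j$, where $W_{\mathcal J}$ is uniform over $\mathbb F_q^{F_{\mathcal J}}$ and has to be decoded by every user $k\in\mathcal J$. Nonnegative rates $(R_{\mathcal J})_{|\mathcal J|=j}$ are achievable if for every $\epsilon>0$ there is a code of some block length $n\ge1$ such that, for each user $k$, the probability that it fails to decode one of its messages is less than $\epsilon$, and $R_{\mathcal J}<F_{\mathcal J}/n$ for all $\mathcal J$. The sum capacity of order-$j$ messages $R^j(K)$ is the supremum of $\sum_{|\mathcal J|=j}R_{\mathcal J}=\binom Kj R_{\mathcal J}$ over the achievable rates that are equal for all $\mathcal J$. Then $R^1(K),\dots,R^K(K)$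 are finite and positive, and for every $N_1>0$ $$R^1(K)=\frac{K N_1}{\dfrac{K N_1}{1-\delta^{K}}+\displaystyle\sum_{i=2}^{K}\frac{\binom Ki N_{1\to i}}{R^i(K)}},\qquad N_{1\to i}=\frac{N_1}{1-\delta^K}\,\delta^{K-i+1}(1-\delta)^{i-1}.$$ Here $N_1$ is the number of packets sent for each user in phase 1 of the broadcasting algorithm, whose $K$ sub-phases have length $N_1/(1-\delta^K)$ each, and $N_{1\to i}$ is the number of packets that are created in the sub-phase of a user $k$ in phase 1 (erased at $k$ and at all users outside $\mathcal J$, received by $\mathcal J\setminus\{k\}$) and are to be sent to a set $\mathcal J\ni k$ with $|\mathcal J|=i$ in phase $i$. -/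

import Mathlib

namespace ErasureBC

/-- The subsets of `j` users out of `K`: there is one order-`j` message per such subset. -/
abbrev Group (K j : ℕ) : Type := {J : Finset (Fin K) // J.card = j}

/-- A choice of all the order-`j` messages, the message of the group `J` consisting of
`m J` packets, a packet being one channel symbol in `F`. -/
abbrev Messages (F : Type*) (K j : ℕ) (m : Group K j → ℕ) : Type _ :=
  (J : Group K j) → (Fin (m J) → F)

/-- An order-`j` code of block length `n` for the `K`-user erasure broadcast channel with input
alphabet `F` and state feedback. The state of a slot is the set of the users that receive the
packet. The symbol sent in slot `l` depends on the messages and on the states of the slots before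
`l`. User `k` estimates the messages of the groups to which it belongs from its own `n` outputs
(`none` stands for an erasure) and from the `n` states. -/
structure Code (F : Type*) (K j n : ℕ) (m : Group K j → ℕ) where
  encode : (l : Fin n) → Messages F K j m → (Fin (l : ℕ) → Finset (Fin K)) → F
  decode : (k : Fin K) → (Fin n → Option F) → (Fin n → Finset (Fin K)) →
    (J : Group K j) → k ∈ J.1 → (Fin (m J) → F)

/-- Probability of the state `S` in one slot: the users receive the packet independently of each
other, each of them with probability `1 - δ`. -/
noncomputable def stateProb (K : ℕ) (δ : ℝ) (S : Finset (Fin K)) : ℝ :=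
  ∏ k : Fin K, if k ∈ S then 1 - δ else δ

namespace Code

variable {F : Type*} {K j n : ℕ} {m : Group K j → ℕ}

/-- The symbol sent in slot `l`, for the messages `w` and the state sequence `s`. -/
def input (c : Code F K j n m) (w : Messages F K j m) (s : Fin n → Finset (Fin K))
    (l : Fin n) : F :=
  c.encode l w fun i => s (Fin.castLE l.isLt.le i)

/-- The output of user `k` in slot `l`. -/
def output (c : Code F K j n m) (w : Messages F K j m) (s : Fin n → Finset (Fin K))
    (k : Fin K) (l : Fin n) : Option F :=
  if k ∈ s l then some (c.input w s l) else none

/-- User `k` fails to recover one of the messages intended to it. -/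
def Fails (c : Code F K j n m) (w : Messages F K j m) (s : Fin n → Finset (Fin K))
    (k : Fin K) : Prop :=
  ∃ (J : Group K j) (hk : k ∈ J.1), c.decode k (c.output w s k) s J hk ≠ w J

open Classical in
/-- Error probability of user `k`: the messages are independent and uniformly distributed, the
states are independent of the messages and independent and identically distributed over the
slots. -/
noncomputable def errorProb [Fintype F] (c : Code F K j n m) (δ : ℝ) (k : Fin K) : ℝ :=
  (Fintype.card (Messages F K j m) : ℝ)⁻¹ *
    ∑ w : Messages F K j m, ∑ s : Fin n → Finset (Fin K),
      if c.Fails w s k then ∏ l : Fin n, stateProb K δ (s l) else 0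

end Code

/-- The tuple of rates `R J` (in packets per slot) is achievable for the order-`j` messages. -/
def IsAchievable (F : Type*) [Fintype F] (K j : ℕ) (δ : ℝ) (R : Group K j → ℝ) : Prop :=
  (∀ J, 0 ≤ R J) ∧
    ∀ ε : ℝ, 0 < ε → ∃ (n : ℕ) (m : Group K j → ℕ) (c : Code F K j n m), 0 < n ∧
      (∀ k, c.errorProb δ k < ε) ∧ ∀ J, R J < (m J : ℝ) / n

/-- The sum rates `∑ J, R J` of the achievable tuples in which all order-`j` messages have the
same rate. -/
def sumRates (F : Type*) [Fintype F] (K j : ℕ) (δ : ℝ) : Set ℝ :=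
  {r | ∃ R : Group K j → ℝ, IsAchievable F K j δ R ∧ (∀ J J', R J = R J') ∧ r = ∑ J, R J}

/-- The sum capacity of order-`j` messages. -/
noncomputable def sumCapacity (F : Type*) [Fintype F] (K j : ℕ) (δ : ℝ) : ℝ :=
  sSup (sumRates F K j δ)

/-- Length of each of the `K` sub-phases of phase 1, in which the `N₁` packets of one user are
sent, each of them until at least one of the `K` users has received it. -/
noncomputable def phaseOneLength (K : ℕ) (δ N₁ : ℝ) : ℝ := N₁ / (1 - δ ^ K)

/-- Number of the packets created in the sub-phase of a user `k` of phase 1 that have to be sent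
in the sub-phase of a given group `J` of `i` users containing `k`: in a slot such a packet arises
if it is erased at `k` and at the `K - i` users outside `J` and received by the other `i - 1`
users of `J`. -/
noncomputable def packetsFromPhaseOne (K : ℕ) (δ N₁ : ℝ) (i : ℕ) : ℝ :=
  phaseOneLength K δ N₁ * δ ^ (K - i + 1) * (1 - δ) ^ (i - 1)

end ErasureBC

namespace ErasureBC

/-! Write T_j for `slotsPerPacket K j δ`, the sum over a < K of C(K-1-a, j-1) / (1 - δ^(a+1)).
Everything rests on R^j(K) = C(K,j) / T_j (`sumCapacity_eq`); the formula is then an identity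
between the T_j.

Identity (`slotsPerPacket_one_eq`). The binomial theorem gives δ^(a+1) = ∑_i C(K-1-a, i) δ^(K-i)
(1-δ)^i. Inserting this in the numerator of 1/(1-x) = 1 + x/(1-x) with x = δ^(a+1), and summing over
a, gives T_1 = K + ∑_{i<K} δ^(K-i) (1-δ)^i T_{i+1}. The term i = 0 is δ^K T_1; moving it to the left
produces the factor 1 - δ^K.

Converse (`IsAchievable.mul_slotsPerPacket_le`). Let the users below a pool their outputs, and let
S(a,b) be the expected sum over the slots of the entropy of the input given the pool's past outputs
and all messages wanted by users below b. The input does not depend on the current state and the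
pool misses a slot with probability δ^a, so the final joint entropy of these messages and outputs is
H(W_b) + (1 - δ^a) S(a,b), where W_b is the family of these messages. By Fano, the pool of users 0,
..., a learns the messages whose least user is a, of which there are C(K-1-a, j-1); hence their
entropy is at most about (1 - δ^(a+1)) (S(a+1,a) - S(a+1,a+1)). A larger pool leaves less
uncertainty, S(a+1,a) ≤ S(a,a), so division by 1 - δ^(a+1) and summation telescope to at most S(0,0)
≤ n log q.

Achievability (`isAchievable_of_mul_slotsPerPacket_lt`). Each set L of users has a sub-phase,
smaller sets first, sending random linear combinations of the messages of L and of the earlier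
symbols promoted to L: a symbol of sub-phase J received by S moves to J ∪ S. User k decodes from the
largest sets down; it succeeds if in each L ∋ k it has sufficiently more equations than unknowns,
which a union bound over matrices and a Chernoff bound over states ensure. The required lengths
satisfy a triangular linear system, solved by a Neumann series whose total is T_j. -/

/-! ### Independent states and expectations over them -/

theorem sum_prod_ite_mem {ι R : Type*} [Fintype ι] [DecidableEq ι] [CommSemiring R] (f g : ι → R) :
    ∑ S : Finset ι, ∏ i, (if i ∈ S then f i else g i) = ∏ i, (f i + g i) := by
  rw [Finset.prod_add, Finset.powerset_univ]
  refine Finset.sum_congr rfl fun S _ => ?_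
  rw [Finset.prod_ite]
  congr 1
  · exact Finset.prod_congr (by ext; simp) fun _ _ => rfl
  · exact Finset.prod_congr (by ext; simp) fun _ _ => rfl

theorem sum_stateProb (K : ℕ) (δ : ℝ) : ∑ S, stateProb K δ S = 1 := by
  unfold stateProb
  rw [sum_prod_ite_mem (fun _ => 1 - δ) (fun _ => δ)]
  simp

theorem stateProb_nonneg {K : ℕ} {δ : ℝ} (h0 : 0 ≤ δ) (h1 : δ ≤ 1) (S : Finset (Fin K)) :
    0 ≤ stateProb K δ S := by
  refine Finset.prod_nonneg fun k _ => ?_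
  split_ifs <;> linarith

/-- Expectation over the i.i.d. states of `n` slots. -/
noncomputable def stateExp (K n : ℕ) (δ : ℝ) (φ : (Fin n → Finset (Fin K)) → ℝ) : ℝ :=
  ∑ s, (∏ l, stateProb K δ (s l)) * φ s

section stateExp

variable {K n : ℕ} {δ : ℝ}

theorem stateExp_prod (g : Fin n → Finset (Fin K) → ℝ) :
    stateExp K n δ (fun s => ∏ l, g l (s l)) = ∏ l, ∑ S, stateProb K δ S * g l S := by
  unfold stateExp
  rw [Finset.prod_univ_sum]
  simp [Finset.prod_mul_distrib]

theorem stateExp_const (a : ℝ) : stateExp K n δ (fun _ => a) = a := by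
  have h := stateExp_prod (K := K) (n := n) (δ := δ) (fun _ _ => 1)
  simp only [mul_one, sum_stateProb, Finset.prod_const_one] at h
  unfold stateExp at h ⊢
  rw [← Finset.sum_mul]
  simp only [mul_one] at h
  rw [h, one_mul]

theorem stateExp_sub (φ ψ : (Fin n → Finset (Fin K)) → ℝ) :
    stateExp K n δ (fun s => φ s - ψ s) = stateExp K n δ φ - stateExp K n δ ψ := by
  simp [stateExp, mul_sub, Finset.sum_sub_distrib]

theorem stateExp_const_mul (a : ℝ) (φ : (Fin n → Finset (Fin K)) → ℝ) :
    stateExp K n δ (fun s => a * φ s) = a * stateExp K n δ φ := by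
  simp [stateExp, Finset.mul_sum, mul_left_comm]

theorem stateExp_sum {ι : Type*} (I : Finset ι) (φ : ι → (Fin n → Finset (Fin K)) → ℝ) :
    stateExp K n δ (fun s => ∑ i ∈ I, φ i s) = ∑ i ∈ I, stateExp K n δ (φ i) := by
  simp only [stateExp, Finset.mul_sum]
  exact Finset.sum_comm

theorem stateExp_mono (h0 : 0 ≤ δ) (h1 : δ ≤ 1) {φ ψ : (Fin n → Finset (Fin K)) → ℝ}
    (h : ∀ s, φ s ≤ ψ s) : stateExp K n δ φ ≤ stateExp K n δ ψ :=
  Finset.sum_le_sum fun s _ => mul_le_mul_of_nonneg_left (h s)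
    (Finset.prod_nonneg fun _ _ => stateProb_nonneg h0 h1 _)

theorem prod_stateProb_update (s : Fin n → Finset (Fin K)) (l : Fin n) (S : Finset (Fin K)) :
    (∏ i, stateProb K δ (Function.update s l S i)) * stateProb K δ (s l) =
      (∏ i, stateProb K δ (s i)) * stateProb K δ S := by
  rw [← Finset.mul_prod_erase _ _ (Finset.mem_univ l),
    ← Finset.mul_prod_erase Finset.univ (fun i => stateProb K δ (s i)) (Finset.mem_univ l)]
  have : ∏ x ∈ Finset.univ.erase l, stateProb K δ (Function.update s l S x) =
      ∏ x ∈ Finset.univ.erase l, stateProb K δ (s x) :=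
    Finset.prod_congr rfl fun x hx => by rw [Function.update_of_ne (Finset.ne_of_mem_erase hx)]
  rw [this, Function.update_self]
  ring

/-- A function of the state of slot `l` is independent of a function that ignores slot `l`. -/
theorem stateExp_mul_apply (l : Fin n) (φ : (Fin n → Finset (Fin K)) → ℝ)
    (χ : Finset (Fin K) → ℝ) (hφ : ∀ s S, φ (Function.update s l S) = φ s) :
    stateExp K n δ (fun s => χ (s l) * φ s) =
      (∑ S, stateProb K δ S * χ S) * stateExp K n δ φ := by
  -- An independent extra state is exchanged with the state of slot `l`. The involution preserves
  -- the product weight (`prod_stateProb_update`) and does not change `φ`.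
  let e : (Fin n → Finset (Fin K)) × Finset (Fin K) ≃ (Fin n → Finset (Fin K)) × Finset (Fin K) :=
    { toFun := fun p => (Function.update p.1 l p.2, p.1 l)
      invFun := fun p => (Function.update p.1 l p.2, p.1 l)
      left_inv := fun p => by simp
      right_inv := fun p => by simp }
  have h1 : stateExp K n δ (fun s => χ (s l) * φ s) =
      ∑ p : (Fin n → Finset (Fin K)) × Finset (Fin K),
        (∏ i, stateProb K δ (p.1 i)) * (χ (p.1 l) * φ p.1) * stateProb K δ p.2 := by
    rw [Fintype.sum_prod_type]
    simp only [← Finset.mul_sum, sum_stateProb, mul_one]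
    rfl
  rw [h1, ← e.sum_comp, Fintype.sum_prod_type, stateExp, Finset.sum_mul_sum, Finset.sum_comm]
  refine Finset.sum_congr rfl fun S _ => Finset.sum_congr rfl fun s _ => ?_
  have h2 := prod_stateProb_update (δ := δ) s l S
  simp only [e, Equiv.coe_fn_mk, Function.update_self, hφ]
  linear_combination (χ S * φ s) * h2

end stateExp

/-! ### Entropy of functions on a finite uniform space -/

open Classical in
/-- Number of the points that `f` does not distinguish from `w`. -/
noncomputable def fiberCard {Ω A : Type*} [Fintype Ω] (f : Ω → A) (w : Ω) : ℕ :=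
  (Finset.univ.filter fun w' => f w' = f w).card

/-- Shannon entropy (in nats) of the value of `f` at a uniformly distributed point. -/
noncomputable def entropy {Ω A : Type*} [Fintype Ω] (f : Ω → A) : ℝ :=
  Real.log (Fintype.card Ω) - (Fintype.card Ω : ℝ)⁻¹ * ∑ w, Real.log (fiberCard f w)

section entropy

variable {Ω A B C : Type*} [Fintype Ω]

theorem fiberCard_pos (f : Ω → A) (w : Ω) : 0 < fiberCard f w :=
  Finset.card_pos.2 ⟨w, by simp⟩

theorem fiberCard_le_of_imp {f : Ω → A} {g : Ω → B} {w : Ω}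
    (h : ∀ w', f w' = f w → g w' = g w) : fiberCard f w ≤ fiberCard g w :=
  Finset.card_le_card fun w' => by simpa using h w'

theorem entropy_le_of_imp {f : Ω → A} {g : Ω → B} (h : ∀ w w', g w' = g w → f w' = f w) :
    entropy f ≤ entropy g := by
  unfold entropy
  gcongr with w
  · exact_mod_cast fiberCard_pos g w
  · exact fiberCard_le_of_imp (h w)

theorem entropy_congr {f : Ω → A} {g : Ω → B} (h : ∀ w w', g w' = g w ↔ f w' = f w) :
    entropy f = entropy g :=
  le_antisymm (entropy_le_of_imp fun w w' => (h w w').1) (entropy_le_of_imp fun w w' => (h w w').2)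

/-- Weighting each point by the inverse size of its fibre counts every attained value exactly once.
-/
theorem sum_div_fiberCard_le (f : Ω → A) (S : Finset A) (q : A → ℝ) (hq : ∀ a ∈ S, 0 ≤ q a)
    (hf : ∀ w, f w ∈ S) : ∑ w, q (f w) / fiberCard f w ≤ ∑ a ∈ S, q a := by
  classical
  rw [← Finset.sum_fiberwise_of_maps_to (t := S) (g := f) (fun w _ => hf w)]
  refine Finset.sum_le_sum fun a ha => ?_
  rcases Finset.eq_empty_or_nonempty (Finset.univ.filter fun w => f w = a) with h | ⟨w₀, hw₀⟩
  · rw [h, Finset.sum_empty]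
    exact hq a ha
  · have h0 : f w₀ = a := (Finset.mem_filter.1 hw₀).2
    have hcard : (0 : ℝ) < fiberCard f w₀ := by exact_mod_cast fiberCard_pos f w₀
    have : ∑ w ∈ Finset.univ.filter (fun w => f w = a), q (f w) / fiberCard f w =
        ∑ w ∈ Finset.univ.filter (fun w => f w = a), q a / fiberCard f w₀ := by
      refine Finset.sum_congr rfl fun w hw => ?_
      have hw : f w = a := (Finset.mem_filter.1 hw).2
      simp only [fiberCard, hw, h0]
    rw [this, Finset.sum_const, nsmul_eq_mul]
    have : (Finset.univ.filter fun w => f w = a).card = fiberCard f w₀ := by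
      rw [fiberCard, h0]
    rw [this, mul_div_cancel₀ _ hcard.ne']

/-- Gibbs' inequality: a conditional entropy is at most the cross entropy with respect to any
sub-stochastic kernel. -/
theorem entropy_prod_sub_le [Fintype A] [Nonempty Ω] (f : Ω → A) (g : Ω → B) (q : B → A → ℝ)
    (hq0 : ∀ b a, 0 ≤ q b a) (hq : ∀ w, 0 < q (g w) (f w)) (hq1 : ∀ w, ∑ a, q (g w) a ≤ 1) :
    entropy (fun w => (f w, g w)) - entropy g ≤
      (Fintype.card Ω : ℝ)⁻¹ * ∑ w, -Real.log (q (g w) (f w)) := by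
  classical
  have hΩ : (0 : ℝ) < Fintype.card Ω := by exact_mod_cast Fintype.card_pos
  unfold entropy
  rw [show ∀ a b c : ℝ, a - b - (a - c) = c - b by intros; ring, ← mul_sub, ← Finset.sum_sub_distrib]
  refine mul_le_mul_of_nonneg_left ?_ (by positivity)
  rw [← sub_nonpos, ← Finset.sum_sub_distrib]
  -- Pointwise `log t ≤ t - 1`, with t the ratio of `q` to the true conditional probability; the
  -- mean of t is at most 1.
  have hpt : ∀ w, Real.log (fiberCard g w) - Real.log (fiberCard (fun w => (f w, g w)) w) -
      -Real.log (q (g w) (f w)) ≤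
      fiberCard g w * q (g w) (f w) / fiberCard (fun w => (f w, g w)) w - 1 := by
    intro w
    have h1 : (0 : ℝ) < fiberCard g w := by exact_mod_cast fiberCard_pos g w
    have h2 : (0 : ℝ) < fiberCard (fun w => (f w, g w)) w := by exact_mod_cast fiberCard_pos _ w
    have h3 := hq w
    have := Real.log_le_sub_one_of_pos (show 0 < fiberCard g w * q (g w) (f w) /
      fiberCard (fun w => (f w, g w)) w by positivity)
    rw [Real.log_div (by positivity) h2.ne', Real.log_mul h1.ne' h3.ne'] at this
    linarith
  refine (Finset.sum_le_sum fun w _ => hpt w).trans ?_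
  rw [Finset.sum_sub_distrib, sub_nonpos]
  let N : B → ℝ := fun b => (Finset.univ.filter fun w => g w = b).card
  have hB : ∑ w, fiberCard g w * q (g w) (f w) / fiberCard (fun w => (f w, g w)) w ≤
      ∑ p ∈ (Finset.univ : Finset A) ×ˢ Finset.univ.image g, N p.2 * q p.2 p.1 := by
    exact sum_div_fiberCard_le (fun w => (f w, g w)) _ (fun p : A × B => N p.2 * q p.2 p.1)
      (fun p _ => mul_nonneg (Nat.cast_nonneg _) (hq0 _ _)) (by simp)
  refine hB.trans ?_
  rw [Finset.sum_product_right]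
  calc ∑ b ∈ Finset.univ.image g, ∑ a, N b * q b a
      ≤ ∑ b ∈ Finset.univ.image g, N b := by
        refine Finset.sum_le_sum fun b hb => ?_
        obtain ⟨w, -, rfl⟩ := Finset.mem_image.1 hb
        rw [← Finset.mul_sum]
        exact mul_le_of_le_one_right (Nat.cast_nonneg _) (hq1 w)
    _ = ∑ w : Ω, 1 := by
        simp only [N]
        rw [← Nat.cast_sum, ← Finset.card_eq_sum_card_image]
        simp

theorem entropy_le_entropy_prod (f : Ω → A) (g : Ω → B) :
    entropy g ≤ entropy fun w => (f w, g w) :=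
  entropy_le_of_imp fun _ _ h => (Prod.ext_iff.1 h).2

theorem entropy_prod_sub_le_log_card [Fintype A] [Nonempty A] [Nonempty Ω] (f : Ω → A) (g : Ω → B) :
    entropy (fun w => (f w, g w)) - entropy g ≤ Real.log (Fintype.card A) := by
  have hA : (0 : ℝ) < Fintype.card A := by exact_mod_cast Fintype.card_pos
  have hΩ : (0 : ℝ) < Fintype.card Ω := by exact_mod_cast Fintype.card_pos
  refine (entropy_prod_sub_le f g (fun _ _ => (Fintype.card A : ℝ)⁻¹) (fun _ _ => by positivity)
    (fun _ => by positivity) fun _ => ?_).trans (le_of_eq ?_)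
  · simp [hA.ne']
  · simp [Real.log_inv, hΩ.ne']

/-- Conditioning on a finer function reduces entropy. -/
theorem entropy_prod_sub_le_of_imp [Fintype A] [Nonempty Ω] (f : Ω → A) {g : Ω → B} {g' : Ω → C}
    (h : ∀ w w', g w' = g w → g' w' = g' w) :
    entropy (fun w => (f w, g w)) - entropy g ≤ entropy (fun w => (f w, g' w)) - entropy g' := by
  classical
  have hΩ : (0 : ℝ) < Fintype.card Ω := by exact_mod_cast Fintype.card_pos
  -- Since `g` determines `g'`, a representative of each value of `g` suffices to write the
  -- conditional law of `f` given `g'` as a kernel in the value of `g`.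
  let w₀ : B → Ω := fun b => if hb : ∃ w, g w = b then hb.choose else Classical.arbitrary Ω
  have hw₀ : ∀ w, g' (w₀ (g w)) = g' w := fun w => h _ _ (by
    have hb : ∃ w', g w' = g w := ⟨w, rfl⟩
    simp only [w₀, dif_pos hb]
    exact hb.choose_spec)
  let q : B → A → ℝ := fun b a =>
    ((Finset.univ.filter fun w => f w = a ∧ g' w = g' (w₀ b)).card : ℝ) / fiberCard g' (w₀ b)
  have hqw : ∀ w, q (g w) (f w) = fiberCard (fun w => (f w, g' w)) w / fiberCard g' w := fun w => by
    simp only [q, fiberCard, hw₀, Prod.mk.injEq]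
  have hpos : ∀ w, (0 : ℝ) < fiberCard g' w := fun w => by exact_mod_cast fiberCard_pos g' w
  have hpos' : ∀ w, (0 : ℝ) < fiberCard (fun w => (f w, g' w)) w := fun w => by
    exact_mod_cast fiberCard_pos _ w
  refine (entropy_prod_sub_le f g q (fun b a => by positivity)
    (fun w => by rw [hqw]; exact div_pos (hpos' w) (hpos w)) fun w => ?_).trans (le_of_eq ?_)
  · simp only [q]
    rw [← Finset.sum_div, div_le_one (hpos _), ← Nat.cast_sum]
    refine le_of_eq ?_
    congr 1
    rw [fiberCard, Finset.card_eq_sum_card_fiberwise (f := f) (t := Finset.univ) (by simp)]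
    refine Finset.sum_congr rfl fun a _ => ?_
    rw [Finset.filter_filter]
    simp only [and_comm]
  · unfold entropy
    rw [show ∀ a b c : ℝ, a - b - (a - c) = c - b by intros; ring, ← mul_sub,
      ← Finset.sum_sub_distrib]
    congr 1
    refine Finset.sum_congr rfl fun w _ => ?_
    rw [hqw, Real.log_div (hpos' w).ne' (hpos w).ne']
    ring

open Classical in
/-- Fano's inequality, with a free parameter `c` in place of the binary entropy. -/
theorem entropy_prod_sub_le_fano [Fintype A] [Nonempty Ω] (f : Ω → A) (g : Ω → B) (d : B → A)
    {c : ℝ} (hc0 : 0 < c) (hc1 : c < 1) :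
    entropy (fun w => (f w, g w)) - entropy g ≤
      ((Fintype.card Ω : ℝ)⁻¹ * ∑ w, if d (g w) = f w then 0 else 1) *
        (Real.log (Fintype.card A) - Real.log c) - Real.log (1 - c) := by
  have hΩ : (0 : ℝ) < Fintype.card Ω := by exact_mod_cast Fintype.card_pos
  have : Nonempty A := ⟨f (Classical.arbitrary Ω)⟩
  have hA : (0 : ℝ) < Fintype.card A := by exact_mod_cast Fintype.card_pos
  have hc : 0 < 1 - c := by linarith
  -- Mass 1 - c on the guess and mass c spread uniformly, so that a wrong guess costs at most log
  -- |A| - log c.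
  let q : B → A → ℝ := fun b a => (if d b = a then 1 - c else 0) + c / Fintype.card A
  have hq : ∀ b a, 0 < q b a := fun b a => by
    have : 0 < c / Fintype.card A := by positivity
    simp only [q]
    split_ifs <;> linarith
  refine (entropy_prod_sub_le f g q (fun b a => (hq b a).le) (fun w => hq _ _) fun w => ?_).trans ?_
  · simp only [q]
    rw [Finset.sum_add_distrib, Finset.sum_ite_eq]
    simp [mul_div_cancel₀ _ hA.ne']
  · have hpt : ∀ w, -Real.log (q (g w) (f w)) ≤
        (if d (g w) = f w then 0 else 1) * (Real.log (Fintype.card A) - Real.log c) -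
          Real.log (1 - c) := by
      intro w
      have hcA : 0 < c / Fintype.card A := by positivity
      by_cases h : d (g w) = f w
      · simp only [q, h, if_true, zero_mul, zero_sub, neg_le_neg_iff]
        exact Real.log_le_log hc (by linarith)
      · simp only [q, h, if_false, zero_add, one_mul]
        rw [Real.log_div hc0.ne' hA.ne']
        have := Real.log_nonpos hc.le (by linarith)
        linarith
    calc (Fintype.card Ω : ℝ)⁻¹ * ∑ w, -Real.log (q (g w) (f w))
        ≤ (Fintype.card Ω : ℝ)⁻¹ * ∑ w, ((if d (g w) = f w then 0 else 1) *
          (Real.log (Fintype.card A) - Real.log c) - Real.log (1 - c)) := by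
          gcongr with w
          exact hpt w
      _ = _ := by
          rw [Finset.sum_sub_distrib, ← Finset.sum_mul, Finset.sum_const, nsmul_eq_mul, mul_sub,
            Finset.card_univ, inv_mul_cancel_left₀ hΩ.ne', mul_assoc]

end entropy

/-! ### Converse: pooled receivers -/

/-- The messages that some user of index below `b` has to decode. -/
def headMessages {F : Type*} {K j : ℕ} {m : Group K j → ℕ} (b : ℕ) (w : Messages F K j m)
    (J : {J : Group K j // ∃ k ∈ J.1, (k : ℕ) < b}) : Fin (m J.1) → F :=
  w J.1

/-- The pool misses a slot only if all `a` of its users do. Subtracting that event leaves a product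
over the users. -/
theorem sum_stateProb_ite_exists {K a : ℕ} (δ : ℝ) (ha : a ≤ K) :
    ∑ S : Finset (Fin K), stateProb K δ S * (if ∃ k ∈ S, (k : ℕ) < a then 1 else 0) =
      1 - δ ^ a := by
  have h1 : ∀ S : Finset (Fin K), stateProb K δ S * (if ∃ k ∈ S, (k : ℕ) < a then 1 else 0) =
      stateProb K δ S - ∏ k : Fin K, if k ∈ S then (if (k : ℕ) < a then 0 else 1 - δ) else δ := by
    intro S
    by_cases h : ∃ k ∈ S, (k : ℕ) < a
    · obtain ⟨k, hk, hka⟩ := h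
      rw [if_pos ⟨k, hk, hka⟩, Finset.prod_eq_zero (Finset.mem_univ k) (by simp [hk, hka])]
      simp
    · rw [if_neg h, mul_zero, eq_comm, sub_eq_zero]
      refine Finset.prod_congr rfl fun k _ => ?_
      by_cases hk : k ∈ S
      · simp [hk, show ¬ (k : ℕ) < a from fun hka => h ⟨k, hk, hka⟩]
      · simp [hk]
  rw [Finset.sum_congr rfl fun S _ => h1 S, Finset.sum_sub_distrib, sum_stateProb,
    sum_prod_ite_mem (fun k : Fin K => if (k : ℕ) < a then 0 else 1 - δ) fun _ => δ]
  have h2 : ∀ k : Fin K, (if (k : ℕ) < a then 0 else 1 - δ) + δ = if (k : ℕ) < a then δ else 1 := by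
    intro k; split_ifs <;> ring
  simp only [h2]
  rw [Finset.prod_ite, Finset.prod_const, Finset.prod_const_one, mul_one]
  congr 2
  rw [Fin.card_filter_val_lt, min_eq_right ha]

/-- The groups counted are those whose least user is `a`; the remaining `j - 1` users are chosen
among the K - 1 - a later ones. -/
theorem card_filter_min_eq {K j a : ℕ} (ha : a < K) (hj : 1 ≤ j) :
    (Finset.univ.filter fun J : Group K j =>
      (∃ k ∈ J.1, (k : ℕ) < a + 1) ∧ ¬ ∃ k ∈ J.1, (k : ℕ) < a).card =
      (K - 1 - a).choose (j - 1) := by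
  have hcard : (Finset.Ioi (⟨a, ha⟩ : Fin K)).card = K - 1 - a := by simp
  rw [← hcard, ← Finset.card_powersetCard]
  have key : ∀ J : Group K j, ((∃ k ∈ J.1, (k : ℕ) < a + 1) ∧ ¬ ∃ k ∈ J.1, (k : ℕ) < a) ↔
      (⟨a, ha⟩ : Fin K) ∈ J.1 ∧ ∀ k ∈ J.1, a ≤ (k : ℕ) := by
    intro J
    constructor
    · rintro ⟨⟨k, hk, hka⟩, h⟩
      have h' : ∀ k ∈ J.1, a ≤ (k : ℕ) := fun k hk => not_lt.1 fun hlt => h ⟨k, hk, hlt⟩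
      have : k = ⟨a, ha⟩ := Fin.ext (by have := h' k hk; simp; omega)
      exact ⟨this ▸ hk, h'⟩
    · rintro ⟨h, h'⟩
      exact ⟨⟨_, h, by simp⟩, fun ⟨k, hk, hlt⟩ => absurd (h' k hk) (by omega)⟩
  refine Finset.card_bij (fun J _ => J.1.erase ⟨a, ha⟩) ?_ ?_ ?_
  · intro J hJ
    obtain ⟨h, h'⟩ := (key J).1 (Finset.mem_filter.1 hJ).2
    rw [Finset.mem_powersetCard, Finset.card_erase_of_mem h, J.2]
    refine ⟨fun k hk => ?_, rfl⟩
    have h1 := h' k (Finset.mem_of_mem_erase hk)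
    have h2 := Finset.ne_of_mem_erase hk
    rw [Finset.mem_Ioi]
    exact lt_of_le_of_ne (Fin.mk_le_of_le_val h1) h2.symm
  · intro J hJ J' hJ' he
    have h := ((key J).1 (Finset.mem_filter.1 hJ).2).1
    have h' := ((key J').1 (Finset.mem_filter.1 hJ').2).1
    exact Subtype.ext (by rw [← Finset.insert_erase h, he, Finset.insert_erase h'])
  · intro T hT
    obtain ⟨hT1, hT2⟩ := Finset.mem_powersetCard.1 hT
    have hn : (⟨a, ha⟩ : Fin K) ∉ T := fun h => by simpa using hT1 h
    refine ⟨⟨insert ⟨a, ha⟩ T, by rw [Finset.card_insert_of_notMem hn, hT2]; omega⟩, ?_, ?_⟩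
    · refine Finset.mem_filter.2 ⟨Finset.mem_univ _, (key _).2 ⟨Finset.mem_insert_self _ _, ?_⟩⟩
      intro k hk
      rcases Finset.mem_insert.1 hk with rfl | hk
      · exact le_rfl
      · exact (Fin.lt_def.1 (Finset.mem_Ioi.1 (hT1 hk))).le
    · exact Finset.erase_insert hn

namespace Code

variable {F : Type*} {K j n : ℕ} {m : Group K j → ℕ} (c : Code F K j n m)

theorem input_congr (w : Messages F K j m) {s s' : Fin n → Finset (Fin K)} {t : Fin n}
    (h : ∀ i, i < t → s i = s' i) : c.input w s t = c.input w s' t := by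
  unfold input
  congr 1
  funext i
  exact h _ (Fin.lt_def.2 i.2)

/-- The outputs, in the slots before `l`, of the pool of the users of index below `a`. -/
def poolOutput (a l : ℕ) (s : Fin n → Finset (Fin K)) (w : Messages F K j m) (t : Fin n) :
    Option F :=
  if (t : ℕ) < l ∧ ∃ k ∈ s t, (k : ℕ) < a then some (c.input w s t) else none

theorem poolOutput_eq_of_le {a a' l : ℕ} (haa : a ≤ a') {s : Fin n → Finset (Fin K)}
    {w w' : Messages F K j m} (h : c.poolOutput a' l s w' = c.poolOutput a' l s w) :
    c.poolOutput a l s w' = c.poolOutput a l s w := by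
  funext t
  by_cases ht : (t : ℕ) < l ∧ ∃ k ∈ s t, (k : ℕ) < a
  · have ht' : (t : ℕ) < l ∧ ∃ k ∈ s t, (k : ℕ) < a' := by
      obtain ⟨h1, k, h2, h3⟩ := ht
      exact ⟨h1, k, h2, h3.trans_le haa⟩
    have := congrFun h t
    unfold poolOutput at this ⊢
    rw [if_pos ht', if_pos ht'] at this
    rwa [if_pos ht, if_pos ht]
  · unfold poolOutput
    rw [if_neg ht, if_neg ht]

variable [Fintype F]

/-- Entropy of the messages of the users of index below `b` together with the pooled outputs. -/
noncomputable def poolEntropy (a b l : ℕ) (s : Fin n → Finset (Fin K)) : ℝ :=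
  entropy fun w => (headMessages b w, c.poolOutput a l s w)

/-- Entropy of the input of slot `l`, given what users of index below `a` have received, and given
the messages intended to users of index below `b`. -/
noncomputable def inputEntropy (a b : ℕ) (l : Fin n) (s : Fin n → Finset (Fin K)) : ℝ :=
  entropy (fun w => (c.input w s l, headMessages b w, c.poolOutput a l s w)) -
    c.poolEntropy a b l s

/-- Chain rule for a fixed state sequence: slot `l` either reveals its input to the pool or adds
nothing. -/
theorem poolEntropy_succ_sub (a b : ℕ) (l : Fin n) (s : Fin n → Finset (Fin K)) :
    c.poolEntropy a b (l + 1) s - c.poolEntropy a b l s =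
      (if ∃ k ∈ s l, (k : ℕ) < a then 1 else 0) * c.inputEntropy a b l s := by
  by_cases h : ∃ k ∈ s l, (k : ℕ) < a
  · rw [if_pos h, one_mul, inputEntropy]
    congr 1
    refine entropy_congr fun w w' => ?_
    simp only [Prod.mk.injEq]
    constructor
    · rintro ⟨h1, h2, h3⟩
      refine ⟨h2, funext fun t => ?_⟩
      rcases lt_trichotomy t l with ht | rfl | ht
      · have := congrFun h3 t
        have hlt : (t : ℕ) < l := ht
        simpa [poolOutput, hlt, Nat.lt_succ_of_lt hlt] using this
      · simp [poolOutput, h1]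
      · have hlt : ¬ (t : ℕ) < l + 1 := by have := Fin.lt_def.1 ht; omega
        simp [poolOutput, hlt]
    · rintro ⟨h2, h3⟩
      refine ⟨?_, h2, funext fun t => ?_⟩
      · have := congrFun h3 l
        simpa [poolOutput, h] using this
      · by_cases hlt : (t : ℕ) < l
        · have := congrFun h3 t
          simpa [poolOutput, hlt, Nat.lt_succ_of_lt hlt] using this
        · simp [poolOutput, hlt]
  · rw [if_neg h, zero_mul, sub_eq_zero]
    suffices hout : ∀ w, c.poolOutput a (l + 1) s w = c.poolOutput a l s w by
      simp only [poolEntropy, hout]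
    intro w
    funext t
    rcases lt_trichotomy t l with ht | rfl | ht
    · have hlt : (t : ℕ) < l := ht
      simp [poolOutput, hlt, Nat.lt_succ_of_lt hlt]
    · unfold poolOutput
      rw [if_neg fun h' => h h'.2, if_neg fun h' => h h'.2]
    · have := Fin.lt_def.1 ht
      have hlt : ¬ (t : ℕ) < l + 1 := by omega
      have hlt' : ¬ (t : ℕ) < l := by omega
      simp [poolOutput, hlt, hlt']

/-- Causality of the feedback: the input and the past outputs are fixed before the state of slot `l`
is drawn. This is what lets reception and entropy factor in expectation. -/
theorem inputEntropy_update (a b : ℕ) (l : Fin n) (s : Fin n → Finset (Fin K))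
    (S : Finset (Fin K)) :
    c.inputEntropy a b l (Function.update s l S) = c.inputEntropy a b l s := by
  have h1 : ∀ i, i < l → Function.update s l S i = s i := fun i hi =>
    Function.update_of_ne hi.ne _ _
  have h2 : ∀ w, c.input w (Function.update s l S) l = c.input w s l := fun w =>
    c.input_congr w h1
  have h3 : ∀ w, c.poolOutput a l (Function.update s l S) w = c.poolOutput a l s w := by
    intro w
    funext t
    by_cases ht : (t : ℕ) < l
    · simp only [poolOutput, ht, true_and, h1 t ht,
        c.input_congr w (t := t) fun i hi => h1 i (hi.trans ht)]
    · simp [poolOutput, ht]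
  simp only [inputEntropy, poolEntropy, h2, h3]

theorem inputEntropy_nonneg (a b : ℕ) (l : Fin n) (s : Fin n → Finset (Fin K)) :
    0 ≤ c.inputEntropy a b l s :=
  sub_nonneg.2 (entropy_le_entropy_prod _ _)

theorem inputEntropy_le_log_card [Nonempty F] (a b : ℕ) (l : Fin n) (s : Fin n → Finset (Fin K)) :
    c.inputEntropy a b l s ≤ Real.log (Fintype.card F) :=
  entropy_prod_sub_le_log_card (fun w => c.input w s l) fun w =>
    (headMessages b w, c.poolOutput a l s w)

theorem inputEntropy_anti [Nonempty F] {a a' : ℕ} (haa : a ≤ a') (b : ℕ) (l : Fin n)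
    (s : Fin n → Finset (Fin K)) : c.inputEntropy a' b l s ≤ c.inputEntropy a b l s :=
  entropy_prod_sub_le_of_imp (fun w => c.input w s l)
    (g := fun w => (headMessages b w, c.poolOutput a' l s w))
    (g' := fun w => (headMessages b w, c.poolOutput a l s w)) fun w w' h => by
      simp only [Prod.mk.injEq] at h ⊢
      exact ⟨h.1, c.poolOutput_eq_of_le haa h.2⟩

noncomputable def sumInputEntropy (δ : ℝ) (a b : ℕ) : ℝ :=
  ∑ l, stateExp K n δ (c.inputEntropy a b l)

/-- Telescoping over the slots; in each of them, reception by the pool is independent of the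
conditional entropy of the input. -/
theorem stateExp_poolEntropy (δ : ℝ) {a : ℕ} (ha : a ≤ K) (b : ℕ) :
    stateExp K n δ (c.poolEntropy a b n) =
      entropy (headMessages (F := F) (m := m) b) + (1 - δ ^ a) * c.sumInputEntropy δ a b := by
  have hstep : ∀ l : Fin n, stateExp K n δ (c.poolEntropy a b (l + 1)) -
      stateExp K n δ (c.poolEntropy a b l) =
        (1 - δ ^ a) * stateExp K n δ (c.inputEntropy a b l) := by
    intro l
    rw [← stateExp_sub]
    simp only [c.poolEntropy_succ_sub]
    rw [stateExp_mul_apply l (c.inputEntropy a b l)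
      (fun S => if ∃ k ∈ S, (k : ℕ) < a then 1 else 0) (c.inputEntropy_update a b l),
      sum_stateProb_ite_exists δ ha]
  have h0 : stateExp K n δ (c.poolEntropy a b 0) = entropy (headMessages (F := F) (m := m) b) := by
    have : ∀ s, c.poolEntropy a b 0 s = entropy (headMessages (F := F) (m := m) b) := fun s =>
      entropy_congr fun w w' => by
        have h : c.poolOutput a 0 s w' = c.poolOutput a 0 s w := by
          funext t
          simp [poolOutput]
        simp [h]
    simp only [stateExp_const, funext this]
  rw [sumInputEntropy, Finset.mul_sum, ← Finset.sum_congr rfl fun l _ => hstep l, ← h0,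
    Fin.sum_univ_eq_sum_range (fun l => stateExp K n δ (c.poolEntropy a b (l + 1)) -
      stateExp K n δ (c.poolEntropy a b l)) n,
    Finset.sum_range_sub fun l => stateExp K n δ (c.poolEntropy a b l)]
  ring

open Classical in
-- A fibre fixes the listed messages and leaves the others free, so its size is a product over the
-- other groups.
theorem entropy_headMessages [Nonempty F] (b : ℕ) :
    entropy (headMessages (F := F) (m := m) b) =
      (∑ J : Group K j with ∃ k : Fin K, k ∈ J.1 ∧ (k : ℕ) < b, (m J : ℝ)) *
        Real.log (Fintype.card F) := by
  have hF : (Fintype.card F : ℝ) ≠ 0 := by exact_mod_cast Fintype.card_ne_zero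
  have hfib : ∀ w, (fiberCard (headMessages (F := F) (m := m) b) w : ℝ) =
      ∏ J : Group K j with ¬ ∃ k : Fin K, k ∈ J.1 ∧ (k : ℕ) < b,
        (Fintype.card F : ℝ) ^ m J := by
    intro w
    have : fiberCard (headMessages (F := F) (m := m) b) w =
        (Fintype.piFinset fun J : Group K j =>
          if ∃ k : Fin K, k ∈ J.1 ∧ (k : ℕ) < b then {w J} else Finset.univ).card := by
      unfold fiberCard
      congr 1
      ext w'
      simp only [Finset.mem_filter, Finset.mem_univ, true_and, Fintype.mem_piFinset]
      constructor
      · intro h J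
        split_ifs with hJ
        · exact Finset.mem_singleton.2 (congrFun h ⟨J, hJ⟩)
        · exact Finset.mem_univ _
      · intro h
        funext J
        have := h J.1
        rw [if_pos J.2, Finset.mem_singleton] at this
        exact this
    rw [this, Fintype.card_piFinset]
    push_cast
    rw [Finset.prod_filter]
    refine Finset.prod_congr rfl fun J _ => ?_
    by_cases hJ : ∃ k : Fin K, k ∈ J.1 ∧ (k : ℕ) < b
    · rw [if_pos hJ, if_neg (not_not.2 hJ)]
      simp
    · rw [if_neg hJ, if_pos hJ]
      simp
  have hΩ : (Fintype.card (Messages F K j m) : ℝ) ≠ 0 := by exact_mod_cast Fintype.card_ne_zero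
  unfold entropy
  simp only [hfib]
  rw [Finset.sum_const, nsmul_eq_mul, Finset.card_univ, inv_mul_cancel_left₀ hΩ,
    Real.log_prod (fun J _ => pow_ne_zero _ hF)]
  have hcard : Real.log (Fintype.card (Messages F K j m)) =
      ∑ J : Group K j, (m J : ℝ) * Real.log (Fintype.card F) := by
    rw [Fintype.card_pi]
    simp only [Fintype.card_fun, Fintype.card_fin]
    push_cast
    rw [Real.log_prod fun J _ => pow_ne_zero _ hF]
    simp
  rw [hcard, ← Finset.sum_filter_add_sum_filter_not _ fun J : Group K j =>
    ∃ k : Fin K, k ∈ J.1 ∧ (k : ℕ) < b]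
  simp only [Real.log_pow, Finset.sum_mul, add_sub_cancel_right]

open Classical in
theorem entropy_headMessages_succ_sub [Nonempty F] (a : ℕ) :
    entropy (headMessages (F := F) (m := m) (a + 1)) -
        entropy (headMessages (F := F) (m := m) a) =
      (∑ J : Group K j with (∃ k : Fin K, k ∈ J.1 ∧ (k : ℕ) < a + 1) ∧
        ¬ ∃ k : Fin K, k ∈ J.1 ∧ (k : ℕ) < a, (m J : ℝ)) * Real.log (Fintype.card F) := by
  rw [entropy_headMessages, entropy_headMessages, ← sub_mul,
    ← Finset.sum_filter_add_sum_filter_not (Finset.univ.filter fun J : Group K j =>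
      ∃ k : Fin K, k ∈ J.1 ∧ (k : ℕ) < a + 1) fun J => ∃ k : Fin K, k ∈ J.1 ∧ (k : ℕ) < a,
    Finset.filter_filter, Finset.filter_filter]
  have : (Finset.univ.filter fun J : Group K j => (∃ k : Fin K, k ∈ J.1 ∧ (k : ℕ) < a + 1) ∧
      ∃ k : Fin K, k ∈ J.1 ∧ (k : ℕ) < a) =
      Finset.univ.filter fun J : Group K j => ∃ k : Fin K, k ∈ J.1 ∧ (k : ℕ) < a := by
    refine Finset.filter_congr fun J _ => and_iff_right_of_imp ?_
    rintro ⟨k, hk, hka⟩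
    exact ⟨k, hk, by omega⟩
  rw [this, add_sub_cancel_left]

open Classical in
theorem poolEntropy_sub_le_fano [Nonempty F] {a : ℕ} (ha : a < K) {x : ℝ} (hx0 : 0 < x)
    (hx1 : x < 1) (s : Fin n → Finset (Fin K)) :
    c.poolEntropy (a + 1) (a + 1) n s - c.poolEntropy (a + 1) a n s ≤
      ((Fintype.card (Messages F K j m) : ℝ)⁻¹ *
        ∑ w, if c.Fails w s ⟨a, ha⟩ then 1 else 0) *
          (entropy (headMessages (F := F) (m := m) (a + 1)) -
            entropy (headMessages (F := F) (m := m) a) - Real.log x) - Real.log (1 - x) := by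
  let New := {J : Group K j // (∃ k ∈ J.1, (k : ℕ) < a + 1) ∧ ¬ ∃ k ∈ J.1, (k : ℕ) < a}
  let A := (J : New) → Fin (m J.1) → F
  let f : Messages F K j m → A := fun w J => w J.1
  have hmem : ∀ J : New, (⟨a, ha⟩ : Fin K) ∈ J.1.1 := by
    rintro ⟨J, ⟨k, hk, hka⟩, h⟩
    have : k = ⟨a, ha⟩ := Fin.ext (by
      have : ¬ (k : ℕ) < a := fun hlt => h ⟨k, hk, hlt⟩
      simp only
      omega)
    exact this ▸ hk
  let g := fun w : Messages F K j m => (headMessages a w, c.poolOutput (a + 1) n s w)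
  -- User `a` belongs to the pool, so its decoder can be run on the pool's outputs with the slots
  -- that it missed blanked out.
  let d : (((J : {J : Group K j // ∃ k ∈ J.1, (k : ℕ) < a}) → Fin (m J.1) → F) ×
      (Fin n → Option F)) → A := fun z J =>
    c.decode ⟨a, ha⟩ (fun t => if (⟨a, ha⟩ : Fin K) ∈ s t then z.2 t else none) s J.1 (hmem J)
  have hd : ∀ w, ¬ c.Fails w s ⟨a, ha⟩ → d (g w) = f w := by
    intro w hw
    have hout : (fun t => if (⟨a, ha⟩ : Fin K) ∈ s t then c.poolOutput (a + 1) n s w t else none) =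
        c.output w s ⟨a, ha⟩ := by
      funext t
      unfold output poolOutput
      by_cases ht : (⟨a, ha⟩ : Fin K) ∈ s t
      · rw [if_pos ht, if_pos ht, if_pos ⟨t.2, _, ht, by simp⟩]
      · rw [if_neg ht, if_neg ht]
    funext J
    simp only [d, g, f, hout]
    by_contra hne
    exact hw ⟨J.1, hmem J, hne⟩
  have hcardA : Real.log (Fintype.card A) = entropy (headMessages (F := F) (m := m) (a + 1)) -
      entropy (headMessages (F := F) (m := m) a) := by
    have hF : (Fintype.card F : ℝ) ≠ 0 := by exact_mod_cast Fintype.card_ne_zero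
    rw [entropy_headMessages_succ_sub, Fintype.card_pi]
    simp only [Fintype.card_fun, Fintype.card_fin]
    push_cast
    rw [Real.log_prod fun J _ => pow_ne_zero _ hF]
    simp only [Real.log_pow, ← Finset.sum_mul]
    congr 1
    exact (Finset.sum_subtype _ (fun J => by simp) fun J : Group K j => (m J : ℝ)).symm
  have hfano := entropy_prod_sub_le_fano f g d hx0 hx1
  have hcongr : entropy (fun w => (f w, g w)) = c.poolEntropy (a + 1) (a + 1) n s := by
    refine entropy_congr fun w w' => ?_
    simp only [g, Prod.mk.injEq]
    constructor
    · rintro ⟨h1, h2⟩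
      refine ⟨funext fun J => congrFun h1 ⟨J.1, J.2.1⟩, funext fun J => ?_, h2⟩
      obtain ⟨k, hk, hka⟩ := J.2
      exact congrFun h1 ⟨J.1, k, hk, by omega⟩
    · rintro ⟨h1, h2, h3⟩
      refine ⟨funext fun J => ?_, h3⟩
      by_cases hJ : ∃ k ∈ J.1.1, (k : ℕ) < a
      · exact congrFun h2 ⟨J.1, hJ⟩
      · exact congrFun h1 ⟨J.1, J.2, hJ⟩
  rw [hcongr, hcardA] at hfano
  refine hfano.trans (sub_le_sub_right (mul_le_mul_of_nonneg_right ?_ ?_) _)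
  · gcongr with w
    by_cases h : c.Fails w s ⟨a, ha⟩
    · rw [if_pos h]
      split_ifs <;> norm_num
    · rw [if_pos (hd w h), if_neg h]
  · rw [← hcardA]
    have h1 := Real.log_natCast_nonneg (Fintype.card A)
    have h2 := Real.log_nonpos hx0.le hx1.le
    linarith

open Classical in
theorem errorProb_eq_stateExp (δ : ℝ) (k : Fin K) :
    c.errorProb δ k = stateExp K n δ fun s => (Fintype.card (Messages F K j m) : ℝ)⁻¹ *
      ∑ w, if c.Fails w s k then 1 else 0 := by
  unfold errorProb stateExp
  rw [Finset.sum_comm, Finset.mul_sum]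
  refine Finset.sum_congr rfl fun s _ => ?_
  rw [mul_left_comm, Finset.mul_sum Finset.univ _ (∏ l, stateProb K δ (s l))]
  simp only [mul_ite, mul_one, mul_zero]

theorem entropy_step_le [Nonempty F] {δ : ℝ} (h0 : 0 ≤ δ) (h1 : δ ≤ 1) {a : ℕ} (ha : a < K)
    {x : ℝ} (hx0 : 0 < x) (hx1 : x < 1) (hc : c.errorProb δ ⟨a, ha⟩ ≤ x) :
    (1 - x) * (entropy (headMessages (F := F) (m := m) (a + 1)) -
        entropy (headMessages (F := F) (m := m) a)) + x * Real.log x + Real.log (1 - x) ≤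
      (1 - δ ^ (a + 1)) *
        (c.sumInputEntropy δ (a + 1) a - c.sumInputEntropy δ (a + 1) (a + 1)) := by
  have hfano := stateExp_mono (n := n) h0 h1 (c.poolEntropy_sub_le_fano ha hx0 hx1)
  have hmono : entropy (headMessages (F := F) (m := m) a) ≤
      entropy (headMessages (F := F) (m := m) (a + 1)) := by
    rw [← sub_nonneg, entropy_headMessages_succ_sub]
    exact mul_nonneg (Finset.sum_nonneg fun _ _ => Nat.cast_nonneg _)
      (Real.log_natCast_nonneg _)
  have hlog := Real.log_nonpos hx0.le hx1.le
  simp only [mul_comm _ (_ - Real.log x)] at hfano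
  rw [stateExp_sub, stateExp_sub, stateExp_const, stateExp_const_mul, ← errorProb_eq_stateExp,
    c.stateExp_poolEntropy δ ha, c.stateExp_poolEntropy δ ha, Nat.succ_eq_add_one] at hfano
  have := mul_le_mul_of_nonneg_left hc (show 0 ≤ entropy (headMessages (F := F) (m := m) (a + 1)) -
    entropy (headMessages (F := F) (m := m) a) - Real.log x by linarith)
  linarith

/-- Weak converse for a single code. -/
theorem sum_entropy_div_le [Nonempty F] {δ : ℝ} (h0 : 0 ≤ δ) (h1 : δ < 1)
    {x : ℝ} (hx0 : 0 < x) (hx1 : x < 1) (hc : ∀ k, c.errorProb δ k ≤ x) :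
    ∑ a ∈ Finset.range K, ((1 - x) * (entropy (headMessages (F := F) (m := m) (a + 1)) -
        entropy (headMessages (F := F) (m := m) a)) + x * Real.log x + Real.log (1 - x)) /
          (1 - δ ^ (a + 1)) ≤ n * Real.log (Fintype.card F) := by
  have hstep : ∀ a ∈ Finset.range K, ((1 - x) * (entropy (headMessages (F := F) (m := m) (a + 1)) -
        entropy (headMessages (F := F) (m := m) a)) + x * Real.log x + Real.log (1 - x)) /
          (1 - δ ^ (a + 1)) ≤ c.sumInputEntropy δ a a - c.sumInputEntropy δ (a + 1) (a + 1) := by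
    intro a ha
    have ha := Finset.mem_range.1 ha
    have hpos : 0 < 1 - δ ^ (a + 1) := sub_pos.2 (pow_lt_one₀ h0 h1 (by omega))
    rw [div_le_iff₀ hpos, mul_comm _ (1 - δ ^ (a + 1))]
    refine (c.entropy_step_le h0 h1.le ha hx0 hx1 (hc _)).trans ?_
    gcongr
    -- Shrinking the pool from `a + 1` to `a` raises the first term, so that consecutive bounds
    -- telescope.
    exact Finset.sum_le_sum fun l _ => stateExp_mono h0 h1.le
      fun s => c.inputEntropy_anti (by omega) a l s
  refine (Finset.sum_le_sum hstep).trans ?_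
  rw [Finset.sum_range_sub' fun a => c.sumInputEntropy δ a a]
  have hK : 0 ≤ c.sumInputEntropy δ K K := Finset.sum_nonneg fun l _ => by
    rw [← stateExp_const (K := K) (n := n) (δ := δ) 0]
    exact stateExp_mono h0 h1.le fun s => c.inputEntropy_nonneg K K l s
  have h00 : c.sumInputEntropy δ 0 0 ≤ n * Real.log (Fintype.card F) := by
    calc c.sumInputEntropy δ 0 0 ≤ ∑ l : Fin n, Real.log (Fintype.card F) := by
          refine Finset.sum_le_sum fun l _ => ?_
          rw [← stateExp_const (K := K) (n := n) (δ := δ) (Real.log (Fintype.card F))]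
          exact stateExp_mono h0 h1.le fun s => c.inputEntropy_le_log_card 0 0 l s
      _ = _ := by simp
  linarith

end Code

/-! ### Converse: the rate bound -/

/-- Number of slots needed per packet of each of the order-`j` messages. -/
noncomputable def slotsPerPacket (K j : ℕ) (δ : ℝ) : ℝ :=
  ∑ a ∈ Finset.range K, ((K - 1 - a).choose (j - 1) : ℝ) / (1 - δ ^ (a + 1))

theorem IsAchievable.mul_slotsPerPacket_le {F : Type*} [Fintype F] [Nontrivial F] {K j : ℕ}
    (hj : 1 ≤ j) {δ : ℝ} (h0 : 0 ≤ δ) (h1 : δ < 1) {r : ℝ}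
    (h : IsAchievable F K j δ fun _ => r) : r * slotsPerPacket K j δ ≤ 1 := by
  classical
  have hq : 0 < Real.log (Fintype.card F) :=
    Real.log_pos (by exact_mod_cast Fintype.one_lt_card)
  have hpos : ∀ a : ℕ, 0 < 1 - δ ^ (a + 1) := fun a =>
    sub_pos.2 (pow_lt_one₀ h0 h1 (by omega))
  -- `x` is at once the error level and the free parameter of Fano's inequality; letting it tend to
  -- 0 removes both losses.
  have hx : ∀ x : ℝ, 0 < x → x < 1 →
      (1 - x) * (r * slotsPerPacket K j δ) * Real.log (Fintype.card F) ≤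
        Real.log (Fintype.card F) + (-(x * Real.log x) - Real.log (1 - x)) *
          ∑ a ∈ Finset.range K, 1 / (1 - δ ^ (a + 1)) := by
    intro x hx0 hx1
    obtain ⟨n, m, c, hn, hc, hm⟩ := h.2 x hx0
    have hn' : (1 : ℝ) ≤ n := by exact_mod_cast hn
    have hconv := c.sum_entropy_div_le h0 h1 hx0 hx1 fun k => (hc k).le
    set β := -(x * Real.log x) - Real.log (1 - x) with hβ
    have hβ0 : 0 ≤ β := by
      have h2 := mul_nonpos_of_nonneg_of_nonpos hx0.le (Real.log_nonpos hx0.le hx1.le)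
      have h3 := Real.log_nonpos (show 0 ≤ 1 - x by linarith) (by linarith)
      linarith
    have hterm : ∀ a ∈ Finset.range K,
        (n * ((1 - x) * r * Real.log (Fintype.card F))) *
          (((K - 1 - a).choose (j - 1) : ℝ) / (1 - δ ^ (a + 1))) - β * (1 / (1 - δ ^ (a + 1))) ≤
        ((1 - x) * (entropy (headMessages (F := F) (m := m) (a + 1)) -
          entropy (headMessages (F := F) (m := m) a)) + x * Real.log x + Real.log (1 - x)) /
          (1 - δ ^ (a + 1)) := by
      intro a ha
      have hsum : n * r * ((K - 1 - a).choose (j - 1) : ℝ) ≤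
          ∑ J : Group K j with (∃ k : Fin K, k ∈ J.1 ∧ (k : ℕ) < a + 1) ∧
            ¬ ∃ k : Fin K, k ∈ J.1 ∧ (k : ℕ) < a, (m J : ℝ) := by
        rw [← card_filter_min_eq (Finset.mem_range.1 ha) hj, mul_comm, ← nsmul_eq_mul]
        refine Finset.card_nsmul_le_sum _ _ _ fun J _ => ?_
        have := (lt_div_iff₀ (by linarith : (0 : ℝ) < n)).1 (hm J)
        linarith
      rw [Code.entropy_headMessages_succ_sub, mul_div_assoc', mul_one_div, ← sub_div]
      refine div_le_div_of_nonneg_right ?_ (hpos a).le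
      have := mul_le_mul_of_nonneg_left hsum
        (mul_nonneg (show 0 ≤ 1 - x by linarith) hq.le)
      linarith
    have hsum := (Finset.sum_le_sum hterm).trans hconv
    rw [Finset.sum_sub_distrib, ← Finset.mul_sum, ← Finset.mul_sum] at hsum
    change (n * ((1 - x) * r * Real.log (Fintype.card F))) * slotsPerPacket K j δ - _ ≤ _ at hsum
    set σ := ∑ a ∈ Finset.range K, 1 / (1 - δ ^ (a + 1))
    have hσ : 0 ≤ σ := Finset.sum_nonneg fun a _ => (one_div_pos.2 (hpos a)).le
    -- The loss β does not grow with the block length, so 1 ≤ n is enough to absorb it after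
    -- division by n.
    have h5 : β * σ ≤ n * (β * σ) := le_mul_of_one_le_left (mul_nonneg hβ0 hσ) hn'
    refine le_of_mul_le_mul_left ?_ (show (0 : ℝ) < n by linarith)
    linarith
  have hlim : Filter.Tendsto (fun x : ℝ => (1 - x) * (r * slotsPerPacket K j δ) *
      Real.log (Fintype.card F)) (nhdsWithin 0 (Set.Ioi 0))
      (nhds ((1 - 0) * (r * slotsPerPacket K j δ) * Real.log (Fintype.card F))) :=
    (Continuous.tendsto (by fun_prop) 0).mono_left nhdsWithin_le_nhds
  have hlim' : Filter.Tendsto (fun x : ℝ => Real.log (Fintype.card F) +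
      (-(x * Real.log x) - Real.log (1 - x)) * ∑ a ∈ Finset.range K, 1 / (1 - δ ^ (a + 1)))
      (nhdsWithin 0 (Set.Ioi 0)) (nhds (Real.log (Fintype.card F) +
      (-(0 * Real.log 0) - Real.log (1 - 0)) * ∑ a ∈ Finset.range K, 1 / (1 - δ ^ (a + 1)))) := by
    refine Filter.Tendsto.mono_left (ContinuousAt.tendsto (f := fun x : ℝ => _) ?_)
      nhdsWithin_le_nhds
    have h2 : ContinuousAt (fun x : ℝ => x * Real.log x) 0 := Real.continuous_mul_log.continuousAt
    have h3 : ContinuousAt (fun x : ℝ => Real.log (1 - x)) 0 :=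
      ContinuousAt.log (by fun_prop) (by norm_num)
    exact continuousAt_const.add ((h2.neg.sub h3).mul continuousAt_const)
  have hle := le_of_tendsto_of_tendsto hlim hlim' (by
    filter_upwards [Ioo_mem_nhdsGT (show (0 : ℝ) < 1 by norm_num)] with x hx'
    exact hx x hx'.1 hx'.2)
  simp only [sub_zero, one_mul, zero_mul, neg_zero, Real.log_one, add_zero] at hle
  exact le_of_mul_le_mul_right (by rwa [one_mul]) hq

/-! ### Random linear systems over a finite field -/

section Resolves

variable {F T C : Type*} [Field F] [Fintype C]

/-- The equations in the rows `R` of `G` determine the unknowns in the columns `U`. -/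
def Resolves (G : T → C → F) (R : Finset T) (U : Finset C) : Prop :=
  ∀ x : C → F, (∀ c, c ∉ U → x c = 0) → (∀ t ∈ R, ∑ c, G t c * x c = 0) → x = 0

open Classical in
-- A nonzero linear functional is onto, and its fibres all have the same size.
theorem card_filter_dotProduct_eq_zero [Fintype F] [DecidableEq C] {x : C → F} (hx : x ≠ 0) :
    (Finset.univ.filter fun g : C → F => ∑ c, g c * x c = 0).card * Fintype.card F =
      Fintype.card (C → F) := by
  obtain ⟨c₀, hc₀⟩ := Function.ne_iff.1 hx
  let φ : (C → F) →+ F :=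
    { toFun := fun g => ∑ c, g c * x c
      map_zero' := by simp
      map_add' := fun g g' => by simp [add_mul, Finset.sum_add_distrib] }
  have hφ : ∀ y, y ∈ Set.range φ := fun y => ⟨Pi.single c₀ (y / x c₀), by
    have : φ (Pi.single c₀ (y / x c₀)) = ∑ c, (Pi.single c₀ (y / x c₀) : C → F) c * x c := rfl
    rw [this, Finset.sum_eq_single c₀]
    · simp [div_mul_cancel₀ _ hc₀]
    · intro c _ hc
      simp [hc]
    · simp⟩
  have h := Finset.card_eq_sum_card_fiberwise (f := φ) (s := Finset.univ) (t := Finset.univ)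
    (by simp)
  rw [Finset.sum_congr rfl fun y _ => AddMonoidHom.card_fiber_eq_of_mem_range φ (hφ y) (hφ 0),
    Finset.sum_const, smul_eq_mul, Finset.card_univ, Finset.card_univ, mul_comm] at h
  exact h.symm

variable [Fintype F] [Fintype T] [DecidableEq T] [DecidableEq C]

open Classical in
/-- A uniformly random matrix rarely fails to resolve much fewer unknowns than equations. -/
theorem card_not_resolves_mul_le (R : Finset T) (U : Finset C) :
    (Finset.univ.filter fun G : T → C → F => ¬ Resolves G R U).card * Fintype.card F ^ R.card ≤
      Fintype.card F ^ U.card * Fintype.card (T → C → F) := by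
  -- Union bound over the nonzero vectors supported in `U`: each is annihilated by all rows in `R`
  -- for a fraction q^(-|R|) of the matrices.
  let X : Finset (C → F) :=
    (Fintype.piFinset fun c => if c ∈ U then Finset.univ else {0}).filter fun x => x ≠ 0
  have hX : X.card ≤ Fintype.card F ^ U.card := by
    refine (Finset.card_filter_le _ _).trans (le_of_eq ?_)
    rw [Fintype.card_piFinset, ← Finset.prod_const, ← Finset.prod_subset (Finset.subset_univ U)]
    · exact Finset.prod_congr rfl fun c hc => by rw [if_pos hc, Finset.card_univ]
    · intro c _ hc
      rw [if_neg hc, Finset.card_singleton]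
  have hsub : (Finset.univ.filter fun G : T → C → F => ¬ Resolves G R U) ⊆
      X.biUnion fun x => Finset.univ.filter fun G : T → C → F => ∀ t ∈ R, ∑ c, G t c * x c = 0 := by
    intro G hG
    have hG := (Finset.mem_filter.1 hG).2
    unfold Resolves at hG
    push Not at hG
    obtain ⟨x, hxU, hxR, hx⟩ := hG
    refine Finset.mem_biUnion.2 ⟨x, Finset.mem_filter.2 ⟨Fintype.mem_piFinset.2 fun c => ?_, hx⟩,
      Finset.mem_filter.2 ⟨Finset.mem_univ _, hxR⟩⟩
    split_ifs with hc
    · exact Finset.mem_univ _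
    · exact Finset.mem_singleton.2 (hxU c hc)
  have hx : ∀ x ∈ X, (Finset.univ.filter fun G : T → C → F =>
      ∀ t ∈ R, ∑ c, G t c * x c = 0).card * Fintype.card F ^ R.card =
        Fintype.card (T → C → F) := by
    intro x hx
    have hset : (Finset.univ.filter fun G : T → C → F => ∀ t ∈ R, ∑ c, G t c * x c = 0) =
        Fintype.piFinset fun t => Finset.univ.filter fun g : C → F =>
          t ∈ R → ∑ c, g c * x c = 0 := by
      ext G
      simp
    rw [hset, Fintype.card_piFinset, Fintype.card_pi, ← Finset.prod_const,
      ← Finset.prod_filter_mul_prod_filter_not Finset.univ (fun t => t ∈ R),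
      ← Finset.prod_filter_mul_prod_filter_not (Finset.univ : Finset T) (fun t => t ∈ R)
        (fun _ => Fintype.card (C → F)), mul_right_comm]
    congr 1
    · rw [Finset.filter_univ_mem, ← Finset.prod_mul_distrib]
      refine Finset.prod_congr rfl fun t ht => ?_
      rw [← card_filter_dotProduct_eq_zero (Finset.mem_filter.1 hx).2]
      simp only [ht, true_imp_iff]
    · refine Finset.prod_congr rfl fun t ht => ?_
      simp [(Finset.mem_filter.1 ht).2]
  calc _ ≤ (∑ x ∈ X, (Finset.univ.filter fun G : T → C → F =>
        ∀ t ∈ R, ∑ c, G t c * x c = 0).card) * Fintype.card F ^ R.card :=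
        Nat.mul_le_mul_right _ ((Finset.card_le_card hsub).trans Finset.card_biUnion_le)
    _ = X.card * Fintype.card (T → C → F) := by
        rw [Finset.sum_mul, Finset.sum_congr rfl hx, Finset.sum_const, smul_eq_mul]
    _ ≤ _ := Nat.mul_le_mul_right _ hX

open Classical in
-- For |U| ≤ |R| the union bound q^(|U|-|R|) applies, otherwise the trivial bound 1. For 0 ≤ θ ≤ log
-- q one exponential covers both, in the form needed for a Chernoff bound over the states.
theorem card_not_resolves_le_exp (R : Finset T) (U : Finset C) {θ : ℝ} (hθ0 : 0 ≤ θ)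
    (hθ1 : θ ≤ Real.log (Fintype.card F)) :
    ((Finset.univ.filter fun G : T → C → F => ¬ Resolves G R U).card : ℝ) ≤
      Fintype.card (T → C → F) * Real.exp (θ * ((U.card : ℝ) - R.card)) := by
  have hq : (0 : ℝ) < Fintype.card F := by exact_mod_cast Fintype.card_pos
  rcases le_total R.card U.card with h | h
  · have h1 : ((Finset.univ.filter fun G : T → C → F => ¬ Resolves G R U).card : ℝ) ≤
        Fintype.card (T → C → F) := by exact_mod_cast Finset.card_le_univ _
    have h2 : (R.card : ℝ) ≤ U.card := by exact_mod_cast h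
    exact h1.trans (le_mul_of_one_le_right (Nat.cast_nonneg _)
      (Real.one_le_exp (mul_nonneg hθ0 (by linarith))))
  · have h1 : ((Finset.univ.filter fun G : T → C → F => ¬ Resolves G R U).card : ℝ) *
        (Fintype.card F : ℝ) ^ R.card ≤
          (Fintype.card F : ℝ) ^ U.card * Fintype.card (T → C → F) := by
      exact_mod_cast card_not_resolves_mul_le (F := F) R U
    have h2 : (U.card : ℝ) ≤ R.card := by exact_mod_cast h
    have hpow : ∀ i : ℕ, (Fintype.card F : ℝ) ^ i = Real.exp (Real.log (Fintype.card F) * i) := by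
      intro i
      rw [mul_comm, Real.exp_nat_mul, Real.exp_log hq]
    rw [← le_div_iff₀ (by positivity), hpow, hpow, mul_comm, mul_div_assoc, ← Real.exp_sub,
      ← mul_sub] at h1
    refine h1.trans (mul_le_mul_of_nonneg_left (Real.exp_le_exp.2 ?_) (Nat.cast_nonneg _))
    exact mul_le_mul_of_nonpos_right hθ1 (by linarith)

end Resolves

/-! ### The broadcasting scheme and its decoding -/

section scheme

variable {F : Type*} [Field F] {K j n : ℕ} {m : Group K j → ℕ}
  (ph : Fin n → Finset (Fin K)) (G : Fin n → (Fin n ⊕ (J : Group K j) × Fin (m J)) → F)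

/-- Symbol sent in slot `t`, which belongs to the sub-phase of the users `ph t`: a linear
combination of the message of `ph t` and of the earlier symbols, sent in other sub-phases, for
which `ph t` is the union of their sub-phase and of the users that received them. -/
def symbol (w : Messages F K j m) (s : Fin n → Finset (Fin K)) (t : Fin n) : F :=
  (∑ t' : Fin n, if _h : t' < t then
    (if ph t' ∪ s t' = ph t ∧ ph t' ≠ ph t then G t (Sum.inl t') * symbol w s t' else 0) else 0) +
  ∑ p : (J : Group K j) × Fin (m J),
    if p.1.1 = ph t then G t (Sum.inr p) * w p.1 p.2 else 0
termination_by t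
decreasing_by assumption

/-- The symbols and message packets that are combined in the sub-phase of the users `L`. -/
def combined (w : Messages F K j m) (s : Fin n → Finset (Fin K)) (L : Finset (Fin K)) :
    (Fin n ⊕ (J : Group K j) × Fin (m J)) → F
  | Sum.inl t => if ph t ∪ s t = L ∧ ph t ≠ L then symbol ph G w s t else 0
  | Sum.inr p => if p.1.1 = L then w p.1 p.2 else 0

theorem symbol_eq_sum (hph : ∀ t t', ph t' ⊂ ph t → t' < t) (w : Messages F K j m)
    (s : Fin n → Finset (Fin K)) (t : Fin n) :
    symbol ph G w s t = ∑ c, G t c * combined ph G w s (ph t) c := by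
  rw [symbol, Fintype.sum_sum_type]
  congr 1
  · refine Finset.sum_congr rfl fun t' _ => ?_
    by_cases h : ph t' ∪ s t' = ph t ∧ ph t' ≠ ph t
    · have hlt : t' < t := hph t t' (lt_of_le_of_ne (h.1 ▸ Finset.subset_union_left) h.2)
      simp only [combined, dif_pos hlt, if_pos h]
    · simp only [combined, if_neg h, dite_eq_ite, ite_self, mul_zero]
  · refine Finset.sum_congr rfl fun p _ => ?_
    simp only [combined, mul_ite, mul_zero]

theorem symbol_congr (w : Messages F K j m) {s s' : Fin n → Finset (Fin K)} (t : Fin n)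
    (h : ∀ i, i < t → s i = s' i) : symbol ph G w s t = symbol ph G w s' t := by
  induction t using WellFoundedLT.induction with
  | _ t ih =>
    rw [symbol, symbol]
    congr 1
    refine Finset.sum_congr rfl fun t' _ => ?_
    by_cases ht : t' < t
    · rw [dif_pos ht, dif_pos ht, h t' ht, ih t' ht fun i hi => h i (hi.trans ht)]
    · rw [dif_neg ht, dif_neg ht]

open Classical in
/-- Broadcasting by sub-phases, with arbitrary decoding of what is determined by the outputs. -/
noncomputable def phaseCode : Code F K j n m where
  encode l w past := symbol ph G w (fun i => if h : i < l then past ⟨i, h⟩ else ∅) l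
  decode k y s J _ :=
    if h : ∃ w, (fun t => if k ∈ s t then some (symbol ph G w s t) else none) = y then h.choose J
    else 0

theorem phaseCode_input (w : Messages F K j m) (s : Fin n → Finset (Fin K)) (t : Fin n) :
    (phaseCode ph G).input w s t = symbol ph G w s t :=
  symbol_congr ph G w t fun i hi => by
    simp only [dif_pos hi]
    rfl

/-- The slots of sub-phase `L` whose symbol user `k` learns directly or from later sub-phases. -/
def knownSlots (s : Fin n → Finset (Fin K)) (L : Finset (Fin K)) (k : Fin K) : Finset (Fin n) :=
  Finset.univ.filter fun t => ph t = L ∧ ¬ (ph t ∪ s t = L ∧ k ∉ s t)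

/-- What user `k` has to find out in sub-phase `L`. -/
def unknowns (m : Group K j → ℕ) (s : Fin n → Finset (Fin K)) (L : Finset (Fin K)) (k : Fin K) :
    Finset (Fin n ⊕ (J : Group K j) × Fin (m J)) :=
  (Finset.univ.filter fun t => (ph t ∪ s t = L ∧ k ∉ s t) ∧ ph t ≠ L).disjSum
    (Finset.univ.filter fun p => p.1.1 = L)

theorem not_fails_of_resolves (hph : ∀ t t', ph t' ⊂ ph t → t' < t) (w : Messages F K j m)
    {s : Fin n → Finset (Fin K)} {k : Fin K}
    (hG : ∀ L, k ∈ L → Resolves G (knownSlots ph s L k) (unknowns ph m s L k)) :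
    ¬ (phaseCode ph G).Fails w s k := by
  rintro ⟨J, hk, hJ⟩
  refine hJ ?_
  have hout : (phaseCode ph G).output w s k =
      fun t => if k ∈ s t then some (symbol ph G w s t) else none := by
    funext t
    simp only [Code.output, phaseCode_input]
  have hex : ∃ w', (fun t => if k ∈ s t then some (symbol ph G w' s t) else none) =
      (phaseCode ph G).output w s k := ⟨w, hout.symm⟩
  have hdec : (phaseCode ph G).decode k ((phaseCode ph G).output w s k) s J hk =
      hex.choose J := dif_pos hex
  have hspec := hex.choose_spec
  rw [hdec]
  generalize hex.choose = w' at hspec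
  have hrec : ∀ t, k ∈ s t → symbol ph G w' s t = symbol ph G w s t := by
    intro t ht
    have := congrFun hspec t
    rw [hout] at this
    simpa [ht] using this
  -- Decoding goes from large sets to small ones: a missed symbol is recovered from the larger
  -- sub-phase to which it was promoted. Any message consistent with the outputs then agrees with
  -- the true one.
  have key : ∀ L, k ∈ L → combined ph G w' s L = combined ph G w s L := by
    intro L
    induction L using WellFoundedGT.induction with
    | _ L ih =>
      intro hkL
      rw [← sub_eq_zero]
      refine hG L hkL _ (fun c hc => ?_) fun t ht => ?_
      · rw [Pi.sub_apply, sub_eq_zero]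
        rcases c with t | p
        · simp only [unknowns, Finset.inl_mem_disjSum, Finset.mem_filter, Finset.mem_univ,
            true_and] at hc
          simp only [combined]
          split_ifs with h
          · exact hrec t (by_contra fun hkt => hc ⟨⟨h.1, hkt⟩, h.2⟩)
          · rfl
        · simp only [unknowns, Finset.inr_mem_disjSum, Finset.mem_filter, Finset.mem_univ,
            true_and] at hc
          simp only [combined, if_neg hc]
      · obtain ⟨rfl, ht⟩ := (Finset.mem_filter.1 ht).2
        simp only [Pi.sub_apply, mul_sub, Finset.sum_sub_distrib]
        rw [← symbol_eq_sum ph G hph, ← symbol_eq_sum ph G hph, sub_eq_zero]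
        by_cases hkt : k ∈ s t
        · exact hrec t hkt
        · have hne : ph t ≠ ph t ∪ s t := fun h => ht ⟨h.symm, hkt⟩
          have := congrFun (ih (ph t ∪ s t) (lt_of_le_of_ne Finset.subset_union_left hne)
            (Finset.mem_union_left _ hkL)) (Sum.inl t)
          simpa [combined, hne] using this
  funext i
  have := congrFun (key J.1 hk) (Sum.inr ⟨J, i⟩)
  simpa [combined] using this

end scheme

/-! ### Error probability of the random scheme -/

/-- Probability that a symbol of the sub-phase of `J` still has to be conveyed to user `k` in the
sub-phase of `L`. -/
noncomputable def linkProb (K : ℕ) (δ : ℝ) (J L : Finset (Fin K)) (k : Fin K) : ℝ :=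
  ∑ S, stateProb K δ S * if J ∪ S = L ∧ k ∉ S then 1 else 0

theorem linkProb_nonneg {K : ℕ} {δ : ℝ} (h0 : 0 ≤ δ) (h1 : δ ≤ 1) (J L : Finset (Fin K))
    (k : Fin K) : 0 ≤ linkProb K δ J L k :=
  Finset.sum_nonneg fun S _ => mul_nonneg (stateProb_nonneg h0 h1 S) (by split_ifs <;> norm_num)

theorem linkProb_le_one {K : ℕ} {δ : ℝ} (h0 : 0 ≤ δ) (h1 : δ ≤ 1) (J L : Finset (Fin K))
    (k : Fin K) : linkProb K δ J L k ≤ 1 := by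
  rw [← sum_stateProb K δ]
  refine Finset.sum_le_sum fun S _ => mul_le_of_le_one_right (stateProb_nonneg h0 h1 S) ?_
  split_ifs <;> norm_num

/-- From exp y ≤ 1 + y + y² for |y| ≤ 1, followed by 1 + x ≤ exp x. -/
theorem sum_mul_exp_le {α : Type*} [Fintype α] {p Y : α → ℝ} (hp : ∀ a, 0 ≤ p a)
    (hp1 : ∑ a, p a = 1) (hY : ∀ a, |Y a| ≤ 1) {θ : ℝ} (h0 : 0 ≤ θ) (h1 : θ ≤ 1) :
    ∑ a, p a * Real.exp (θ * Y a) ≤ Real.exp (θ * (∑ a, p a * Y a) + θ ^ 2) := by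
  have hpt : ∀ a, Real.exp (θ * Y a) ≤ 1 + θ * Y a + θ ^ 2 := by
    intro a
    have hle : |θ * Y a| ≤ θ := by
      rw [abs_mul, abs_of_nonneg h0]
      exact mul_le_of_le_one_right h0 (hY a)
    have h2 := (abs_le.1 (Real.abs_exp_sub_one_sub_id_le (hle.trans h1))).2
    have h3 : (θ * Y a) ^ 2 ≤ θ ^ 2 := by
      rw [← sq_abs]
      gcongr
    linarith
  calc ∑ a, p a * Real.exp (θ * Y a) ≤ ∑ a, p a * (1 + θ * Y a + θ ^ 2) :=
        Finset.sum_le_sum fun a _ => mul_le_mul_of_nonneg_left (hpt a) (hp a)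
    _ = (θ * (∑ a, p a * Y a) + θ ^ 2) + 1 := by
        simp only [mul_add, Finset.sum_add_distrib, ← Finset.sum_mul, hp1, Finset.mul_sum,
          mul_left_comm θ]
        ring
    _ ≤ _ := Real.add_one_le_exp _

/-- Contribution of a slot of the sub-phase of `J`, in state `S`, to the number of unknowns minus
the number of equations of user `k` in the sub-phase of `L`. -/
noncomputable def excess {K : ℕ} (L : Finset (Fin K)) (k : Fin K) (J S : Finset (Fin K)) : ℝ :=
  (if J ∪ S = L ∧ k ∉ S then 1 else 0) - if J = L then 1 else 0

theorem abs_excess_le_one {K : ℕ} (L : Finset (Fin K)) (k : Fin K) (J S : Finset (Fin K)) :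
    |excess L k J S| ≤ 1 := by
  unfold excess
  split_ifs <;> norm_num

open Classical in
theorem inv_card_mul_sum_ite_le_one {α : Type*} [Fintype α] (p : α → Prop) :
    (Fintype.card α : ℝ)⁻¹ * ∑ a, (if p a then 1 else 0) ≤ 1 := by
  rw [Finset.sum_boole]
  exact inv_mul_le_one_of_le₀ (by exact_mod_cast Finset.card_le_univ _) (Nat.cast_nonneg _)

open Classical in
-- Derandomization: some matrix does no worse than average. Summing over all of `P` makes this one
-- choice serve all users and sub-phases together.
theorem exists_sum_stateExp_le {𝒢 ι : Type*} [Fintype 𝒢] [Nonempty 𝒢] {K n : ℕ} {δ : ℝ}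
    (hδ0 : 0 ≤ δ) (hδ1 : δ ≤ 1) (P : Finset ι)
    (good : 𝒢 → (Fin n → Finset (Fin K)) → ι → Prop) (β : (Fin n → Finset (Fin K)) → ι → ℝ)
    (h : ∀ s p, ((Finset.univ.filter fun G => ¬ good G s p).card : ℝ) ≤ Fintype.card 𝒢 * β s p) :
    ∃ G, ∑ p ∈ P, stateExp K n δ (fun s => if ¬ good G s p then 1 else 0) ≤
      ∑ p ∈ P, stateExp K n δ fun s => β s p := by
  have hsum : ∑ G : 𝒢, ∑ p ∈ P, stateExp K n δ (fun s => if ¬ good G s p then 1 else 0) ≤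
      ∑ G : 𝒢, ∑ p ∈ P, stateExp K n δ fun s => β s p := by
    rw [Finset.sum_comm, Finset.sum_comm (s := (Finset.univ : Finset 𝒢))]
    refine Finset.sum_le_sum fun p _ => ?_
    rw [← stateExp_sum, Finset.sum_const, nsmul_eq_mul, Finset.card_univ, ← stateExp_const_mul]
    refine stateExp_mono hδ0 hδ1 fun s => ?_
    rw [Finset.sum_boole]
    exact h s p
  obtain ⟨G, -, hG⟩ := Finset.exists_le_of_sum_le Finset.univ_nonempty hsum
  exact ⟨G, hG⟩

section random

variable {F : Type*} [Field F] [Fintype F] {K j n : ℕ} {m : Group K j → ℕ}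
  (ph : Fin n → Finset (Fin K))

open Classical in
theorem card_unknowns_sub_card_knownSlots (s : Fin n → Finset (Fin K)) (L : Finset (Fin K))
    (k : Fin K) :
    ((unknowns ph m s L k).card : ℝ) - (knownSlots ph s L k).card =
      (if h : L.card = j then (m ⟨L, h⟩ : ℝ) else 0) + ∑ t, excess L k (ph t) (s t) := by
  have h1 : ((Finset.univ.filter fun p : (J : Group K j) × Fin (m J) => p.1.1 = L).card : ℝ) =
      if h : L.card = j then (m ⟨L, h⟩ : ℝ) else 0 := by
    split_ifs with h
    · have : (Finset.univ.filter fun p : (J : Group K j) × Fin (m J) => p.1.1 = L) =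
          ({⟨L, h⟩} : Finset (Group K j)).sigma fun _ => Finset.univ := by
        ext p
        simp [Subtype.ext_iff]
      rw [this, Finset.card_sigma]
      simp
    · rw [Finset.filter_false_of_mem fun p _ (hp : p.1.1 = L) => h (hp ▸ p.1.2)]
      simp
  rw [unknowns, Finset.card_disjSum, Nat.cast_add, h1, knownSlots, Finset.card_filter,
    Finset.card_filter, add_comm, add_sub_assoc]
  push_cast
  rw [← Finset.sum_sub_distrib]
  congr 1
  refine Finset.sum_congr rfl fun t _ => ?_
  unfold excess
  by_cases ha : ph t ∪ s t = L ∧ k ∉ s t <;> by_cases hb : ph t = L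
  -- A slot of sub-phase `L` that `k` misses and that is not promoted is neither an equation nor an
  -- unknown; the two indicators of `excess` cancel.
  · rw [if_neg fun h => h.2 hb, if_neg fun h => h.2 ha, if_pos ha, if_pos hb]
    norm_num
  · rw [if_pos ⟨ha, hb⟩, if_neg fun h => h.2 ha, if_pos ha, if_neg hb]
  · rw [if_neg fun h => h.2 hb, if_pos ⟨hb, ha⟩, if_neg ha, if_pos hb]
  · rw [if_neg fun h => ha h.1, if_neg fun h => hb h.1, if_neg ha, if_neg hb]

theorem stateExp_exp_sum_excess_le {δ : ℝ} (hδ0 : 0 ≤ δ) (hδ1 : δ ≤ 1) (L : Finset (Fin K))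
    (k : Fin K) {θ : ℝ} (h0 : 0 ≤ θ) (h1 : θ ≤ 1) :
    stateExp K n δ (fun s => Real.exp (θ * ∑ t, excess L k (ph t) (s t))) ≤
      Real.exp (∑ t, (θ * (linkProb K δ (ph t) L k - if ph t = L then 1 else 0) + θ ^ 2)) := by
  simp only [Finset.mul_sum, Real.exp_sum]
  rw [stateExp_prod fun t S => Real.exp (θ * excess L k (ph t) S)]
  refine Finset.prod_le_prod (fun t _ => Finset.sum_nonneg fun S _ =>
    mul_nonneg (stateProb_nonneg hδ0 hδ1 S) (Real.exp_pos _).le) fun t _ => ?_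
  refine (sum_mul_exp_le (stateProb_nonneg hδ0 hδ1) (sum_stateProb K δ)
    (abs_excess_le_one L k (ph t)) h0 h1).trans (le_of_eq ?_)
  congr 3
  simp only [excess, mul_sub, Finset.sum_sub_distrib, ← Finset.sum_mul, sum_stateProb, one_mul,
    linkProb]

open Classical in
-- User `k` can fail only if some system with k ∈ L is unresolved. The bound sums over all pairs (k,
-- L), hence does not depend on the user.
theorem exists_phaseCode_errorProb_le (hph : ∀ t t', ph t' ⊂ ph t → t' < t) {δ : ℝ}
    (hδ0 : 0 ≤ δ) (hδ1 : δ ≤ 1) {θ : ℝ} (h0 : 0 ≤ θ) (h1 : θ ≤ 1)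
    (hθ : θ ≤ Real.log (Fintype.card F)) :
    ∃ c : Code F K j n m, ∀ k, c.errorProb δ k ≤
      ∑ p : Fin K × Finset (Fin K) with p.1 ∈ p.2,
        Real.exp (θ * (if h : p.2.card = j then (m ⟨p.2, h⟩ : ℝ) else 0) +
          ∑ t, (θ * (linkProb K δ (ph t) p.2 p.1 - if ph t = p.2 then 1 else 0) + θ ^ 2)) := by
  obtain ⟨G, hG⟩ := exists_sum_stateExp_le hδ0 hδ1
    (Finset.univ.filter fun p : Fin K × Finset (Fin K) => p.1 ∈ p.2)
    (fun (G : Fin n → (Fin n ⊕ (J : Group K j) × Fin (m J)) → F) s p =>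
      Resolves G (knownSlots ph s p.2 p.1) (unknowns ph m s p.2 p.1))
    (fun s p => Real.exp (θ * ((if h : p.2.card = j then (m ⟨p.2, h⟩ : ℝ) else 0) +
      ∑ t, excess p.2 p.1 (ph t) (s t)))) fun s p => by
        rw [← card_unknowns_sub_card_knownSlots]
        exact card_not_resolves_le_exp _ _ h0 hθ
  have hexp : ∀ p : Fin K × Finset (Fin K), stateExp K n δ (fun s =>
      Real.exp (θ * ((if h : p.2.card = j then (m ⟨p.2, h⟩ : ℝ) else 0) +
        ∑ t, excess p.2 p.1 (ph t) (s t)))) ≤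
      Real.exp (θ * (if h : p.2.card = j then (m ⟨p.2, h⟩ : ℝ) else 0) +
        ∑ t, (θ * (linkProb K δ (ph t) p.2 p.1 - if ph t = p.2 then 1 else 0) + θ ^ 2)) := by
    intro p
    simp only [mul_add θ, Real.exp_add]
    rw [stateExp_const_mul, ← Real.exp_add]
    simp only [Real.exp_add]
    gcongr
    simpa only [Real.exp_add] using stateExp_exp_sum_excess_le ph hδ0 hδ1 p.2 p.1 h0 h1
  refine ⟨phaseCode ph G, fun k =>
    le_trans ?_ (hG.trans (Finset.sum_le_sum fun p _ => hexp p))⟩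
  rw [Code.errorProb_eq_stateExp, ← stateExp_sum]
  refine stateExp_mono hδ0 hδ1 fun s => ?_
  by_cases hgood : ∀ L, k ∈ L → Resolves G (knownSlots ph s L k) (unknowns ph m s L k)
  · rw [Finset.sum_eq_zero fun w _ => if_neg (not_fails_of_resolves ph G hph w hgood), mul_zero]
    exact Finset.sum_nonneg fun p _ => by split_ifs <;> norm_num
  · push Not at hgood
    obtain ⟨L, hkL, hL⟩ := hgood
    refine le_trans (inv_card_mul_sum_ite_le_one _) ?_
    refine le_trans (le_of_eq ?_) (Finset.single_le_sum (fun p _ => ?_)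
      (Finset.mem_filter.2 ⟨Finset.mem_univ (k, L), hkL⟩))
    · rw [if_pos hL]
    · split_ifs <;> norm_num

end random

/-! ### From sub-phase lengths to achievable rates -/

/-- Slots can be assigned to sub-phases of given lengths, the sub-phases being ordered by the number
of their users. -/
theorem exists_phases {K n : ℕ} {N : Finset (Fin K) → ℕ} (hn : ∑ L, N L = n) :
    ∃ ph : Fin n → Finset (Fin K), (∀ t t', ph t' ⊂ ph t → t' < t) ∧
      ∀ f : Finset (Fin K) → ℝ, ∑ t, f (ph t) = ∑ L, N L * f L := by
  have hcard : Fintype.card ((L : Finset (Fin K)) × Fin (N L)) = n := by simp [hn]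
  let e := (Fintype.equivFinOfCardEq hcard).symm
  let σ := Tuple.sort fun t => (e t).1.card
  refine ⟨fun t => (e (σ t)).1, fun t t' h => ?_, fun f => ?_⟩
  · by_contra hlt
    exact absurd (Finset.card_lt_card h)
      (not_lt.2 (Tuple.monotone_sort (fun t => (e t).1.card) (not_lt.1 hlt)))
  · rw [Equiv.sum_comp σ fun t => f (e t).1, Equiv.sum_comp e fun x => f x.1, Fintype.sum_sigma]
    simp

/-- With `N` packets per message and about N τ(L) slots in sub-phase `L`, the hypothesis `hτ` makes
the expected equations exceed the expected unknowns by about N η, so the error decays exponentially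
in `N`. -/
theorem isAchievable_of_slots {F : Type*} [Field F] [Fintype F] {K j : ℕ} {δ : ℝ} (hδ0 : 0 ≤ δ)
    (hδ1 : δ ≤ 1) {τ : Finset (Fin K) → ℝ} (hτ0 : ∀ L, 0 ≤ τ L) {η : ℝ} (hη : 0 < η)
    (hτ : ∀ L, ∀ k ∈ L,
      (if L.card = j then 1 else 0) + ∑ J, τ J * linkProb K δ J L k + η ≤ τ L)
    {r : ℝ} (hr0 : 0 ≤ r) (hT1 : 0 < ∑ L, τ L) (hr : r * ∑ L, τ L < 1) :
    IsAchievable F K j δ fun _ => r := by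
  classical
  refine ⟨fun _ => hr0, fun ε hε => ?_⟩
  set T := ∑ L, τ L with hT
  have hlog : 0 < Real.log (Fintype.card F) :=
    Real.log_pos (by exact_mod_cast Fintype.one_lt_card)
  -- Small enough that the quadratic Chernoff term θ² N T uses at most half of the linear gain θ N
  -- η.
  obtain ⟨θ, hθ0, hθ1, hθq, hθη⟩ : ∃ θ : ℝ, 0 < θ ∧ θ ≤ 1 ∧ θ ≤ Real.log (Fintype.card F) ∧
      θ * T ≤ η / 2 := by
    refine ⟨min (min 1 (Real.log (Fintype.card F))) (η / 2 / (T + 1)),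
      lt_min (lt_min one_pos hlog) (by positivity), (min_le_left _ _).trans (min_le_left _ _),
      (min_le_left _ _).trans (min_le_right _ _), ?_⟩
    have := (le_div_iff₀ (by linarith : 0 < T + 1)).1
      (min_le_right (min 1 (Real.log (Fintype.card F))) (η / 2 / (T + 1)))
    have h2 : 0 ≤ min (min 1 (Real.log (Fintype.card F))) (η / 2 / (T + 1)) :=
      (lt_min (lt_min one_pos hlog) (by positivity)).le
    linarith
  set B : ℝ := (Fintype.card (Finset (Fin K)) : ℝ) with hB
  let P : Finset (Fin K × Finset (Fin K)) := Finset.univ.filter fun p => p.1 ∈ p.2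
  -- `B`, the number of sub-phases, bounds the total error of rounding their lengths up to integers.
  have hlim : Filter.Tendsto (fun N : ℕ => (P.card : ℝ) *
      Real.exp (θ * B + θ ^ 2 * B + -(θ * η / 2 * N))) Filter.atTop (nhds 0) := by
    rw [← mul_zero (P.card : ℝ)]
    refine Filter.Tendsto.const_mul _ (Real.tendsto_exp_atBot.comp ?_)
    refine Filter.tendsto_atBot_add_const_left _ _ (Filter.tendsto_neg_atTop_atBot.comp ?_)
    exact tendsto_natCast_atTop_atTop.const_mul_atTop (by positivity)
  have hlim' : Filter.Tendsto (fun N : ℕ => (1 - r * T) * (N : ℝ)) Filter.atTop Filter.atTop :=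
    tendsto_natCast_atTop_atTop.const_mul_atTop (by linarith)
  obtain ⟨N, hNε, hNr⟩ := ((hlim.eventually_lt_const hε).and
    (hlim'.eventually_gt_atTop (r * B))).exists
  let len : Finset (Fin K) → ℕ := fun L => ⌈N * τ L⌉₊
  have hlen0 : ∀ L, N * τ L ≤ len L := fun L => Nat.le_ceil _
  have hlen1 : ∀ L, (len L : ℝ) ≤ N * τ L + 1 := fun L =>
    (Nat.ceil_lt_add_one (mul_nonneg (Nat.cast_nonneg _) (hτ0 L))).le
  obtain ⟨n, hn⟩ : ∃ n, ∑ L, len L = n := ⟨_, rfl⟩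
  obtain ⟨ph, hph, hsum⟩ := exists_phases hn
  have hn1 : (n : ℝ) ≤ N * T + B := by
    rw [← hn]
    push_cast
    refine (Finset.sum_le_sum fun L _ => hlen1 L).trans (le_of_eq ?_)
    rw [Finset.sum_add_distrib, ← Finset.mul_sum]
    simp [hB, hT]
  have hNn : r * n < N := by
    have := mul_le_mul_of_nonneg_left hn1 hr0
    linarith
  have hn0 : 0 < n := by
    have hN : (0 : ℝ) < N := (mul_nonneg hr0 (Nat.cast_nonneg _)).trans_lt hNn
    have h3 : (N : ℝ) * T ≤ n := by
      rw [← hn, hT, Finset.mul_sum]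
      push_cast
      exact Finset.sum_le_sum fun L _ => hlen0 L
    exact_mod_cast (mul_pos hN hT1).trans_le h3
  obtain ⟨c, hc⟩ := exists_phaseCode_errorProb_le (F := F) (m := fun _ : Group K j => N) ph hph
    hδ0 hδ1 hθ0.le hθ1 hθq
  refine ⟨n, fun _ => N, c, hn0, fun k => ((hc k).trans ?_).trans_lt hNε, fun J => ?_⟩
  · rw [← nsmul_eq_mul]
    refine Finset.sum_le_card_nsmul _ _ _ fun p hp => Real.exp_le_exp.2 ?_
    rw [Finset.sum_add_distrib, ← Finset.mul_sum,
      hsum fun L => linkProb K δ L p.2 p.1 - if L = p.2 then 1 else 0]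
    simp only [mul_sub, Finset.sum_sub_distrib, mul_ite, mul_one, mul_zero,
      Finset.sum_ite_eq', Finset.mem_univ, if_true, Finset.sum_const, Finset.card_univ,
      Fintype.card_fin, nsmul_eq_mul, dite_eq_ite]
    have h1 : ∑ L, len L * linkProb K δ L p.2 p.1 ≤
        N * ∑ L, τ L * linkProb K δ L p.2 p.1 + B := by
      calc ∑ L, len L * linkProb K δ L p.2 p.1
          ≤ ∑ L, (N * (τ L * linkProb K δ L p.2 p.1) + 1) := by
            refine Finset.sum_le_sum fun L _ => ?_
            have h2 := linkProb_nonneg hδ0 hδ1 L p.2 p.1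
            have h3 := linkProb_le_one hδ0 hδ1 L p.2 p.1
            have := mul_le_mul_of_nonneg_right (hlen1 L) h2
            linarith
        _ = _ := by
            rw [Finset.sum_add_distrib, ← Finset.mul_sum]
            simp [hB]
    have h4 := mul_le_mul_of_nonneg_left (hτ p.2 p.1 (Finset.mem_filter.1 hp).2)
      (Nat.cast_nonneg (α := ℝ) N)
    have h5 := hlen0 p.2
    have h6 : (if p.2.card = j then (N : ℝ) else 0) + ∑ L, len L * linkProb K δ L p.2 p.1 -
        len p.2 ≤ B - N * η := by
      have : (if p.2.card = j then (N : ℝ) else 0) = N * (if p.2.card = j then 1 else 0) := by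
        split_ifs <;> simp
      rw [this]
      linarith
    have h7 := mul_le_mul_of_nonneg_left h6 hθ0.le
    have h8 := mul_le_mul_of_nonneg_right hn1 (sq_nonneg θ)
    have h9 := mul_le_mul_of_nonneg_left hθη (mul_nonneg hθ0.le (Nat.cast_nonneg (α := ℝ) N))
    have h10 : (if p.2.card = j then θ * (N : ℝ) else 0) =
      θ * (if p.2.card = j then (N : ℝ) else 0) := by split_ifs <;> simp
    rw [h10]
    linarith
  · rw [lt_div_iff₀ (by exact_mod_cast hn0)]
    exact hNn

/-! ### Optimal sub-phase lengths -/

theorem linkProb_eq {K : ℕ} (δ : ℝ) {J L : Finset (Fin K)} {k : Fin K} (hkJ : k ∈ J)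
    (hJL : J ⊆ L) :
    linkProb K δ J L k = δ ^ (K - L.card + 1) * (1 - δ) ^ (L.card - J.card) := by
  -- `f` and `g` are the factors of a receiving and of an erased user. They vanish when the event
  -- forbids it: outside `L` and at `k` nobody may receive, and nobody in L \ J may miss. Users of
  -- `J` other than `k` contribute 1.
  let f : Fin K → ℝ := fun i => if i ∈ L ∧ i ≠ k then 1 - δ else 0
  let g : Fin K → ℝ := fun i => if i ∈ L \ J then 0 else δ
  have hS : ∀ S : Finset (Fin K), (stateProb K δ S * if J ∪ S = L ∧ k ∉ S then 1 else 0) =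
      ∏ i, if i ∈ S then f i else g i := by
    intro S
    by_cases h : J ∪ S = L ∧ k ∉ S
    · rw [if_pos h, mul_one, stateProb]
      refine Finset.prod_congr rfl fun i _ => ?_
      by_cases hi : i ∈ S
      · have : i ∈ L ∧ i ≠ k := ⟨h.1 ▸ Finset.mem_union_right _ hi, fun he => h.2 (he ▸ hi)⟩
        simp only [f, if_pos hi, if_pos this]
      · have : i ∉ L \ J := fun hm => by
          rw [Finset.mem_sdiff, ← h.1, Finset.mem_union] at hm
          tauto
        simp only [g, if_neg hi, if_neg this]
    · rw [if_neg h, mul_zero, eq_comm, Finset.prod_eq_zero_iff]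
      by_contra hne
      push Not at hne
      refine h ⟨?_, fun hk => hne k (Finset.mem_univ _) (by simp [f, hk])⟩
      ext i
      have hi := hne i (Finset.mem_univ _)
      rw [Finset.mem_union]
      constructor
      · rintro (hiJ | hiS)
        · exact hJL hiJ
        · by_contra hiL
          exact hi (by simp [f, hiS, hiL])
      · intro hiL
        by_contra hor
        push Not at hor
        exact hi (by simp [g, hor.1, hor.2, hiL])
  rw [linkProb, Finset.sum_congr rfl fun S _ => hS S, sum_prod_ite_mem]
  have hfg : ∀ i, f i + g i = (if i ∈ insert k Lᶜ then δ else 1) *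
      if i ∈ L \ J then 1 - δ else 1 := by
    intro i
    by_cases hik : i = k
    · subst hik
      simp [f, g, hkJ]
    · by_cases hiL : i ∈ L <;> by_cases hiJ : i ∈ J
      · simp [f, g, hik, hiL, hiJ]
      · simp [f, g, hik, hiL, hiJ]
      · exact absurd (hJL hiJ) hiL
      · simp [f, g, hik, hiL, hiJ]
  have hk : k ∉ Lᶜ := by simp [hJL hkJ]
  simp only [hfg, Finset.prod_mul_distrib, Finset.prod_ite_mem, Finset.univ_inter,
    Finset.prod_const]
  rw [Finset.card_insert_of_notMem hk, Finset.card_compl, Fintype.card_fin,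
    Finset.card_sdiff_of_subset hJL]

theorem linkProb_eq_zero {K : ℕ} (δ : ℝ) {J L : Finset (Fin K)} {k : Fin K} (hkL : k ∈ L)
    (h : ¬ (k ∈ J ∧ J ⊆ L)) : linkProb K δ J L k = 0 := by
  refine Finset.sum_eq_zero fun S _ => ?_
  rw [if_neg, mul_zero]
  rintro ⟨rfl, hk⟩
  exact h ⟨(Finset.mem_union.1 hkL).resolve_right hk, Finset.subset_union_left⟩

theorem sum_filter_mem_subset_card {α M : Type*} [Fintype α] [DecidableEq α] [AddCommMonoid M]
    {L : Finset α} {k : α} (hk : k ∈ L) (f : ℕ → M) :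
    ∑ J : Finset α with k ∈ J ∧ J ⊆ L, f J.card =
      ∑ i ∈ Finset.range L.card, (L.card - 1).choose i • f (i + 1) := by
  have hc : (L.erase k).card + 1 = L.card := Finset.card_erase_add_one hk
  have h := Finset.sum_powerset_apply_card (fun i => f (i + 1)) (x := L.erase k)
  rw [hc, show (L.erase k).card = L.card - 1 by omega] at h
  rw [← h]
  refine Finset.sum_nbij' (fun J => J.erase k) (fun J => insert k J) ?_ ?_ ?_ ?_ ?_
  · intro J hJ
    obtain ⟨-, h1⟩ := (Finset.mem_filter.1 hJ).2
    exact Finset.mem_powerset.2 (Finset.erase_subset_erase k h1)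
  · intro J hJ
    refine Finset.mem_filter.2 ⟨Finset.mem_univ _, Finset.mem_insert_self _ _,
      Finset.insert_subset hk ((Finset.mem_powerset.1 hJ).trans (Finset.erase_subset _ _))⟩
  · intro J hJ
    exact Finset.insert_erase (Finset.mem_filter.1 hJ).2.1
  · intro J hJ
    exact Finset.erase_insert fun h => Finset.notMem_erase k L (Finset.mem_powerset.1 hJ h)
  · intro J hJ
    rw [Finset.card_erase_add_one (Finset.mem_filter.1 hJ).2.1]

/-- Contribution of round `r` to the length of a sub-phase of `l + 1` users, for messages of order
`j + 1`. -/
noncomputable def phaseTerm (K : ℕ) (δ : ℝ) (j l r : ℕ) : ℝ :=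
  (l.choose j : ℝ) * ((δ ^ r) ^ (K - l) * (1 - δ ^ r) ^ (l - j))

theorem phaseTerm_nonneg (K : ℕ) {δ : ℝ} (h0 : 0 ≤ δ) (h1 : δ ≤ 1) (j l r : ℕ) :
    0 ≤ phaseTerm K δ j l r := by
  have h2 : δ ^ r ≤ 1 := pow_le_one₀ h0 h1
  have h3 : 0 ≤ 1 - δ ^ r := by linarith
  unfold phaseTerm
  positivity

theorem summable_phaseTerm {K : ℕ} {δ : ℝ} (h0 : 0 ≤ δ) (h1 : δ < 1) (j : ℕ) {l : ℕ} (hl : l < K) :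
    Summable (phaseTerm K δ j l) := by
  refine Summable.of_nonneg_of_le (phaseTerm_nonneg K h0 h1.le j l) (fun r => ?_)
    ((summable_geometric_of_lt_one h0 h1).mul_left (l.choose j : ℝ))
  have h2 : 0 ≤ δ ^ r := pow_nonneg h0 r
  have h3 : δ ^ r ≤ 1 := pow_le_one₀ h0 h1.le
  unfold phaseTerm
  refine mul_le_mul_of_nonneg_left ?_ (Nat.cast_nonneg _)
  calc (δ ^ r) ^ (K - l) * (1 - δ ^ r) ^ (l - j) ≤ (δ ^ r) ^ (K - l) * 1 := by
        gcongr
        exact pow_le_one₀ (by linarith) (by linarith)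
    _ ≤ δ ^ r := by
        rw [mul_one]
        exact pow_le_of_le_one h2 h3 (by omega)

theorem phaseTerm_zero {K : ℕ} (δ : ℝ) {j l : ℕ} :
    phaseTerm K δ j l 0 = if l = j then 1 else 0 := by
  unfold phaseTerm
  rcases lt_trichotomy l j with h | rfl | h
  · rw [Nat.choose_eq_zero_of_lt h, if_neg h.ne]
    simp
  · simp
  · rw [if_neg h.ne']
    simp [show l - j ≠ 0 by omega]

/-- C(l,i) C(i,j) = C(l,j) C(l-j, i-j) reduces the sum to the binomial theorem. -/
theorem sum_choose_mul_choose_mul_pow {R : Type*} [CommSemiring R] (l j : ℕ) (u v : R) :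
    ∑ i ∈ Finset.range (l + 1), (l.choose i : R) * ((i.choose j : R) * (u ^ (l - i) *
      v ^ (i - j))) = (l.choose j : R) * (u + v) ^ (l - j) := by
  rcases lt_or_ge l j with hlj | hlj
  · rw [Nat.choose_eq_zero_of_lt hlj, Finset.sum_eq_zero fun i hi => ?_]
    · simp
    · have := Finset.mem_range.1 hi
      rw [Nat.choose_eq_zero_of_lt (show i < j by omega)]
      simp
  · rw [show l + 1 = j + (l - j + 1) by omega, Finset.sum_range_add,
      Finset.sum_eq_zero fun i hi => ?_, zero_add, add_comm u v, add_pow, Finset.mul_sum]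
    · refine Finset.sum_congr rfl fun p hp => ?_
      have hch : (l.choose (j + p) : R) * ((j + p).choose j : R) =
          (l.choose j : R) * ((l - j).choose p : R) := by
        have := Nat.choose_mul (n := l) (k := j + p) (s := j) (by omega)
        rw [Nat.add_sub_cancel_left] at this
        exact_mod_cast congrArg (Nat.cast (R := R)) this
      rw [← mul_assoc, hch, Nat.add_sub_cancel_left, Nat.sub_add_eq]
      ring
    · rw [Nat.choose_eq_zero_of_lt (Finset.mem_range.1 hi)]
      simp

/-- 1 - δ^(r+1) = (1-δ) δ^r + (1 - δ^r): a user is first reached in the new round or before it.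
Expanding the power sorts by the number of users reached before. -/
theorem phaseTerm_succ {K : ℕ} (δ : ℝ) {j l : ℕ} (hl : l < K) (r : ℕ) :
    phaseTerm K δ j l (r + 1) = ∑ i ∈ Finset.range (l + 1),
      (l.choose i : ℝ) * (δ ^ (K - l) * (1 - δ) ^ (l - i)) * phaseTerm K δ j i r := by
  have h := sum_choose_mul_choose_mul_pow l j ((1 - δ) * δ ^ r) (1 - δ ^ r)
  rw [phaseTerm, show 1 - δ ^ (r + 1) = (1 - δ) * δ ^ r + (1 - δ ^ r) by ring, mul_left_comm, ← h,
    Finset.mul_sum]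
  refine Finset.sum_congr rfl fun i hi => ?_
  have := Finset.mem_range.1 hi
  rw [phaseTerm, mul_pow, show K - i = (K - l) + (l - i) by omega, pow_succ δ r, mul_pow, pow_add]
  ring

/-- Induction on `K` with Pascal's rule on C(K+1, l+1): one half is x times the previous sum, the
other collapses to C(K,j) by the binomial theorem with x + (1 - x) = 1. -/
theorem sum_choose_mul_eq (j K : ℕ) (x : ℝ) :
    ∑ l ∈ Finset.range K, (K.choose (l + 1) : ℝ) *
      ((l.choose j : ℝ) * (x ^ (K - 1 - l) * (1 - x) ^ (l - j))) =
    ∑ a ∈ Finset.range K, ((K - 1 - a).choose j : ℝ) * x ^ a := by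
  induction K with
  | zero => simp
  | succ K ih =>
    have hR : ∑ a ∈ Finset.range (K + 1), ((K + 1 - 1 - a).choose j : ℝ) * x ^ a =
        x * (∑ a ∈ Finset.range K, ((K - 1 - a).choose j : ℝ) * x ^ a) + K.choose j := by
      rw [Finset.sum_range_succ', Finset.mul_sum]
      congr 1
      · refine Finset.sum_congr rfl fun a _ => ?_
        rw [show K + 1 - 1 - (a + 1) = K - 1 - a by omega, pow_succ]
        ring
      · simp
    have hL1 : ∑ l ∈ Finset.range (K + 1), (K.choose (l + 1) : ℝ) *
        ((l.choose j : ℝ) * (x ^ (K + 1 - 1 - l) * (1 - x) ^ (l - j))) =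
        x * ∑ l ∈ Finset.range K, (K.choose (l + 1) : ℝ) *
          ((l.choose j : ℝ) * (x ^ (K - 1 - l) * (1 - x) ^ (l - j))) := by
      rw [Finset.sum_range_succ, Nat.choose_succ_self, Finset.mul_sum]
      simp only [Nat.cast_zero, zero_mul, add_zero]
      refine Finset.sum_congr rfl fun l hl => ?_
      have := Finset.mem_range.1 hl
      rw [show K + 1 - 1 - l = (K - 1 - l) + 1 by omega, pow_succ]
      ring
    have hL2 : ∑ l ∈ Finset.range (K + 1), (K.choose l : ℝ) *
        ((l.choose j : ℝ) * (x ^ (K + 1 - 1 - l) * (1 - x) ^ (l - j))) = K.choose j := by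
      have h := sum_choose_mul_choose_mul_pow K j x (1 - x)
      rwa [add_sub_cancel, one_pow, mul_one] at h
    rw [hR, ← ih, ← hL1, ← hL2, ← Finset.sum_add_distrib]
    refine Finset.sum_congr rfl fun l _ => ?_
    rw [Nat.choose_succ_succ]
    push_cast
    ring

/-- Length, per packet of each message of order `j + 1`, of a sub-phase of `l + 1` users. -/
noncomputable def phaseWeight (K : ℕ) (δ : ℝ) (j l : ℕ) : ℝ :=
  ∑' r, phaseTerm K δ j l r

theorem phaseWeight_nonneg (K : ℕ) {δ : ℝ} (h0 : 0 ≤ δ) (h1 : δ ≤ 1) (j l : ℕ) :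
    0 ≤ phaseWeight K δ j l :=
  tsum_nonneg (phaseTerm_nonneg K h0 h1 j l)

/-- Balance of a sub-phase: fresh packets plus everything promoted from smaller ones, plus its own
lost symbols (i = l). Shifting the series by one round gives it. -/
theorem phaseWeight_eq {K : ℕ} {δ : ℝ} (h0 : 0 ≤ δ) (h1 : δ < 1) (j : ℕ) {l : ℕ} (hl : l < K) :
    phaseWeight K δ j l = (if l = j then 1 else 0) + ∑ i ∈ Finset.range (l + 1),
      (l.choose i : ℝ) * (δ ^ (K - l) * (1 - δ) ^ (l - i)) * phaseWeight K δ j i := by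
  have hs : ∀ i ∈ Finset.range (l + 1), Summable fun r =>
      (l.choose i : ℝ) * (δ ^ (K - l) * (1 - δ) ^ (l - i)) * phaseTerm K δ j i r := fun i hi => by
    have := Finset.mem_range.1 hi
    exact (summable_phaseTerm h0 h1 j (by omega)).mul_left _
  rw [phaseWeight, (summable_phaseTerm h0 h1 j hl).tsum_eq_zero_add, phaseTerm_zero]
  simp only [phaseTerm_succ δ hl]
  rw [Summable.tsum_finsetSum hs]
  simp only [tsum_mul_left, phaseWeight]

/-- For each round the sum over sets is a combination of powers δ^((a+1) r); summing the geometric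
series over r yields the denominators 1 - δ^(a+1). -/
theorem sum_choose_mul_phaseWeight {K : ℕ} {δ : ℝ} (h0 : 0 ≤ δ) (h1 : δ < 1) (j : ℕ) :
    ∑ l ∈ Finset.range K, (K.choose (l + 1) : ℝ) * phaseWeight K δ j l =
      slotsPerPacket K (j + 1) δ := by
  have hs : ∀ l ∈ Finset.range K, Summable fun r =>
      (K.choose (l + 1) : ℝ) * phaseTerm K δ j l r := fun l hl =>
    (summable_phaseTerm h0 h1 j (Finset.mem_range.1 hl)).mul_left _
  have hlt : ∀ a : ℕ, δ ^ (a + 1) < 1 := fun a => pow_lt_one₀ h0 h1 (by omega)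
  have hg : ∀ a ∈ Finset.range K, Summable fun r =>
      ((K - 1 - a).choose j : ℝ) * (δ ^ (a + 1)) ^ r := fun a _ =>
    (summable_geometric_of_lt_one (pow_nonneg h0 _) (hlt a)).mul_left _
  simp only [phaseWeight, ← tsum_mul_left]
  rw [← Summable.tsum_finsetSum hs, slotsPerPacket]
  have hr : ∀ r, ∑ l ∈ Finset.range K, (K.choose (l + 1) : ℝ) * phaseTerm K δ j l r =
      ∑ a ∈ Finset.range K, ((K - 1 - a).choose j : ℝ) * (δ ^ (a + 1)) ^ r := by
    intro r
    have h := congrArg (δ ^ r * ·) (sum_choose_mul_eq j K (δ ^ r))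
    simp only [Finset.mul_sum] at h
    refine Eq.trans (Finset.sum_congr rfl fun l hl => ?_)
      (h.trans (Finset.sum_congr rfl fun a _ => ?_))
    · have := Finset.mem_range.1 hl
      rw [phaseTerm, show K - l = K - 1 - l + 1 by omega, pow_succ (δ ^ r)]
      ring
    · rw [← pow_mul, ← pow_mul, mul_comm (a + 1) r, mul_add, pow_add, mul_one]
      ring
  simp only [hr]
  rw [Summable.tsum_finsetSum hg]
  refine Finset.sum_congr rfl fun a _ => ?_
  rw [tsum_mul_left, tsum_geometric_of_lt_one (pow_nonneg h0 _) (hlt a), div_eq_mul_inv,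
    Nat.add_sub_cancel]

theorem slotsPerPacket_pos {K j : ℕ} (hj : 1 ≤ j) (hjK : j ≤ K) {δ : ℝ} (h0 : 0 ≤ δ)
    (h1 : δ < 1) : 0 < slotsPerPacket K j δ := by
  have hpos : ∀ a : ℕ, 0 < 1 - δ ^ (a + 1) := fun a =>
    sub_pos.2 (pow_lt_one₀ h0 h1 (by omega))
  refine Finset.sum_pos' (fun a _ => div_nonneg (Nat.cast_nonneg _) (hpos a).le)
    ⟨0, Finset.mem_range.2 (by omega), div_pos ?_ (hpos 0)⟩
  exact_mod_cast Nat.choose_pos (by omega)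

theorem isAchievable_of_mul_slotsPerPacket_lt {F : Type*} [Field F] [Fintype F] {K j : ℕ}
    (hj : 1 ≤ j) (hjK : j ≤ K) {δ : ℝ} (h0 : 0 ≤ δ) (h1 : δ < 1) {r : ℝ} (hr0 : 0 ≤ r)
    (hr : r * slotsPerPacket K j δ < 1) : IsAchievable F K j δ fun _ => r := by
  set S := ∑ i ∈ Finset.range K, slotsPerPacket K (i + 1) δ with hS
  have hS0 : 0 ≤ S := Finset.sum_nonneg fun i hi =>
    (slotsPerPacket_pos (by omega) (by have := Finset.mem_range.1 hi; omega) h0 h1).le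
  obtain ⟨η, hη, hηr⟩ : ∃ η : ℝ, 0 < η ∧ r * (slotsPerPacket K j δ + η * S) < 1 := by
    have hrS : 0 < r * S + 1 := by positivity
    refine ⟨(1 - r * slotsPerPacket K j δ) / (r * S + 1), div_pos (by linarith) hrS, ?_⟩
    have h2 : (1 - r * slotsPerPacket K j δ) / (r * S + 1) * (r * S) <
        1 - r * slotsPerPacket K j δ := by
      rw [div_mul_eq_mul_div, div_lt_iff₀ hrS]
      nlinarith
    linarith
  -- An additional load of η packets at every order turns the balance equations into inequalities
  -- with slack η in each sub-phase, at a total cost of η S slots.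
  let W : ℕ → ℝ := fun l => phaseWeight K δ (j - 1) l +
    η * ∑ i ∈ Finset.range K, phaseWeight K δ i l
  have hW0 : ∀ l, 0 ≤ W l := fun l => add_nonneg (phaseWeight_nonneg K h0 h1.le _ _)
    (mul_nonneg hη.le (Finset.sum_nonneg fun i _ => phaseWeight_nonneg K h0 h1.le _ _))
  have hW : ∀ l, l < K → (if l = j - 1 then 1 else 0) + ∑ i ∈ Finset.range (l + 1),
      (l.choose i : ℝ) * (δ ^ (K - l) * (1 - δ) ^ (l - i)) * W i + η = W l := by
    intro l hl
    have h2 : ∑ i ∈ Finset.range K, phaseWeight K δ i l = 1 + ∑ p ∈ Finset.range (l + 1),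
        (l.choose p : ℝ) * (δ ^ (K - l) * (1 - δ) ^ (l - p)) *
          ∑ i ∈ Finset.range K, phaseWeight K δ i p := by
      simp only [Finset.mul_sum]
      rw [Finset.sum_comm, Finset.sum_congr rfl fun i _ => phaseWeight_eq h0 h1 i hl,
        Finset.sum_add_distrib, Finset.sum_ite_eq, if_pos (Finset.mem_range.2 hl)]
    simp only [W, mul_add, Finset.sum_add_distrib]
    rw [phaseWeight_eq h0 h1 (j - 1) hl, h2, mul_add, Finset.mul_sum]
    simp only [mul_left_comm η]
    ring
  -- Weights are indexed by the number of users minus one; the empty set gets no slots.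
  let τ : Finset (Fin K) → ℝ := fun L => if L.card = 0 then 0 else W (L.card - 1)
  have hτsum : ∑ L, τ L = slotsPerPacket K j δ + η * S := by
    have h2 := Finset.sum_powerset_apply_card (fun l => if l = 0 then 0 else W (l - 1))
      (x := (Finset.univ : Finset (Fin K)))
    rw [Finset.powerset_univ, Finset.card_univ, Fintype.card_fin, Finset.sum_range_succ'] at h2
    simp only [Nat.add_eq_zero_iff, one_ne_zero, and_false, if_false, if_true, smul_zero, add_zero,
      Nat.add_sub_cancel, nsmul_eq_mul] at h2
    rw [h2]
    simp only [W, mul_add, Finset.sum_add_distrib]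
    rw [sum_choose_mul_phaseWeight h0 h1, Nat.sub_add_cancel hj, hS]
    congr 1
    simp only [← sum_choose_mul_phaseWeight h0 h1, Finset.mul_sum]
    rw [Finset.sum_comm]
    simp only [mul_left_comm η]
  refine isAchievable_of_slots h0 h1.le (τ := τ) (fun L => ?_) hη (fun L k hk => ?_) hr0 ?_ ?_
  · simp only [τ]
    split_ifs
    · exact le_rfl
    · exact hW0 _
  · obtain ⟨l, hl⟩ : ∃ l, L.card = l + 1 := ⟨L.card - 1, by
      have := Finset.card_pos.2 ⟨k, hk⟩
      omega⟩
    have hlK : l < K := by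
      have := Finset.card_le_univ L
      rw [Fintype.card_fin] at this
      omega
    have h2 : ∑ J, τ J * linkProb K δ J L k = ∑ J : Finset (Fin K) with k ∈ J ∧ J ⊆ L,
        W (J.card - 1) * (δ ^ (K - l) * (1 - δ) ^ (L.card - J.card)) := by
      rw [Finset.sum_filter]
      refine Finset.sum_congr rfl fun J _ => ?_
      split_ifs with hJ
      · simp only [τ]
        rw [if_neg (Finset.card_pos.2 ⟨k, hJ.1⟩).ne', linkProb_eq δ hJ.1 hJ.2, hl,
          show K - (l + 1) + 1 = K - l by omega]
      · rw [linkProb_eq_zero δ hk hJ, mul_zero]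
    have h3 := sum_filter_mem_subset_card hk fun i =>
      W (i - 1) * (δ ^ (K - l) * (1 - δ) ^ (L.card - i))
    rw [h2, h3]
    refine le_of_eq ?_
    simp only [τ, hl, Nat.add_sub_cancel, nsmul_eq_mul, Nat.add_eq_zero_iff, one_ne_zero, and_false,
      if_false, Nat.add_sub_add_right]
    rw [← hW l hlK]
    congr 2
    · exact if_congr (by omega) rfl rfl
    · exact Finset.sum_congr rfl fun i _ => by ring
  · rw [hτsum]
    exact add_pos_of_pos_of_nonneg (slotsPerPacket_pos hj hjK h0 h1) (mul_nonneg hη.le hS0)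
  · rw [hτsum]
    exact hηr

/-! ### Capacity and the recursion between orders -/

theorem isLUB_sumRates {F : Type*} [Field F] [Fintype F] {K j : ℕ} (hj : 1 ≤ j) (hjK : j ≤ K)
    {δ : ℝ} (h0 : 0 ≤ δ) (h1 : δ < 1) :
    IsLUB (sumRates F K j δ) ((K.choose j : ℝ) / slotsPerPacket K j δ) := by
  have hT := slotsPerPacket_pos hj hjK h0 h1
  have hC : (0 : ℝ) < K.choose j := by exact_mod_cast Nat.choose_pos hjK
  have hcard : Fintype.card (Group K j) = K.choose j := by
    rw [Fintype.card_finset_len, Fintype.card_fin]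
  have hne : Nonempty (Group K j) := by
    rw [← Fintype.card_pos_iff, hcard]
    exact Nat.choose_pos hjK
  have hmem : ∀ r : ℝ, 0 ≤ r → r * slotsPerPacket K j δ < 1 →
      K.choose j * r ∈ sumRates F K j δ := fun r hr0 hr =>
    ⟨fun _ => r, isAchievable_of_mul_slotsPerPacket_lt hj hjK h0 h1 hr0 hr, fun _ _ => rfl, by
      rw [Finset.sum_const, Finset.card_univ, hcard, nsmul_eq_mul]⟩
  refine ⟨?_, fun b hb => ?_⟩
  · rintro _ ⟨R, hR, heq, rfl⟩
    obtain ⟨J₀⟩ := hne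
    have hconst : R = fun _ => R J₀ := funext fun J => heq J J₀
    rw [hconst] at hR ⊢
    rw [Finset.sum_const, Finset.card_univ, hcard, nsmul_eq_mul, le_div_iff₀ hT, mul_assoc]
    exact mul_le_of_le_one_right hC.le (hR.mul_slotsPerPacket_le hj h0 h1)
  · have hb0 : 0 ≤ b := by simpa using hb (hmem 0 le_rfl (by simp))
    by_contra hlt
    have hlt := not_le.1 hlt
    obtain ⟨c, hbc, hc⟩ := exists_between hlt
    have hcr : K.choose j * (c / K.choose j) = c := mul_div_cancel₀ c hC.ne'
    have := hb (hmem (c / K.choose j) (div_nonneg (hb0.trans hbc.le) hC.le) (by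
      rwa [div_mul_eq_mul_div, div_lt_one hC, ← lt_div_iff₀ hT]))
    rw [hcr] at this
    exact absurd hbc (not_lt.2 this)

theorem sumCapacity_eq (F : Type*) [Field F] [Fintype F] {K j : ℕ} (hj : 1 ≤ j) (hjK : j ≤ K)
    {δ : ℝ} (h0 : 0 ≤ δ) (h1 : δ < 1) :
    sumCapacity F K j δ = (K.choose j : ℝ) / slotsPerPacket K j δ := by
  have h := isLUB_sumRates (F := F) hj hjK h0 h1
  exact h.csSup_eq h.nonempty

theorem slotsPerPacket_one_eq {K : ℕ} {δ : ℝ} (h0 : 0 ≤ δ) (h1 : δ < 1) :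
    slotsPerPacket K 1 δ = K + ∑ i ∈ Finset.range K,
      δ ^ (K - i) * (1 - δ) ^ i * slotsPerPacket K (i + 1) δ := by
  -- Binomial theorem for ((1-δ) + δ)^(K-1-a), multiplied by δ^(a+1); the terms with i > K-1-a
  -- vanish.
  have hb : ∀ a ∈ Finset.range K, ∑ i ∈ Finset.range K,
      δ ^ (K - i) * (1 - δ) ^ i * ((K - 1 - a).choose i : ℝ) = δ ^ (a + 1) := by
    intro a ha
    have ha := Finset.mem_range.1 ha
    have h := add_pow (1 - δ) δ (K - 1 - a)
    rw [sub_add_cancel, one_pow] at h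
    have h' := congrArg (δ ^ (a + 1) * ·) h
    simp only [mul_one, Finset.mul_sum] at h'
    rw [h']
    refine (Finset.sum_subset (Finset.range_subset_range.2 (by omega)) fun i _ hi => ?_).symm.trans
      (Finset.sum_congr rfl fun i hi => ?_)
    · rw [Finset.mem_range, not_lt] at hi
      rw [Nat.choose_eq_zero_of_lt (by omega)]
      simp
    · have := Finset.mem_range.1 hi
      rw [show K - i = (a + 1) + (K - 1 - a - i) by omega, pow_add]
      ring
  simp only [slotsPerPacket, Finset.mul_sum, Nat.add_sub_cancel]
  rw [Finset.sum_comm]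
  have hterm : ∀ a ∈ Finset.range K, ((K - 1 - a).choose (1 - 1) : ℝ) / (1 - δ ^ (a + 1)) =
      1 + ∑ i ∈ Finset.range K,
        δ ^ (K - i) * (1 - δ) ^ i * (((K - 1 - a).choose i : ℝ) / (1 - δ ^ (a + 1))) := by
    intro a ha
    have hpos : 0 < 1 - δ ^ (a + 1) := sub_pos.2 (pow_lt_one₀ h0 h1 (by omega))
    simp only [mul_div_assoc']
    rw [← Finset.sum_div, hb a ha, Nat.sub_self, Nat.choose_zero_right, Nat.cast_one]
    field_simp
    ring
  rw [Finset.sum_congr rfl hterm, Finset.sum_add_distrib]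
  simp

end ErasureBC

theorem corollary3 (F : Type*) [Field F] [Fintype F] (K : ℕ) (hK : 1 ≤ K)
    (δ : ℝ) (hδ0 : 0 ≤ δ) (hδ1 : δ < 1) (N₁ : ℝ) (hN₁ : 0 < N₁) :
    (∀ i ∈ Finset.Icc 1 K,
      IsLUB (ErasureBC.sumRates F K i δ) (ErasureBC.sumCapacity F K i δ) ∧
        0 < ErasureBC.sumCapacity F K i δ) ∧
    ErasureBC.sumCapacity F K 1 δ =
      (K * N₁) /
        ((K * N₁) / (1 - δ ^ K) +
          ∑ i ∈ Finset.Icc 2 K,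
            ((K.choose i : ℝ) * ErasureBC.packetsFromPhaseOne K δ N₁ i) /
              ErasureBC.sumCapacity F K i δ) := by
  have hC : ∀ i ≤ K, (0 : ℝ) < K.choose i := fun i hi => by exact_mod_cast Nat.choose_pos hi
  constructor
  · intro i hi
    obtain ⟨hi1, hiK⟩ := Finset.mem_Icc.1 hi
    rw [ErasureBC.sumCapacity_eq F hi1 hiK hδ0 hδ1]
    exact ⟨ErasureBC.isLUB_sumRates hi1 hiK hδ0 hδ1,
      div_pos (hC i hiK) (ErasureBC.slotsPerPacket_pos hi1 hiK hδ0 hδ1)⟩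
  · have hpos : 0 < 1 - δ ^ K := sub_pos.2 (pow_lt_one₀ hδ0 hδ1 (by omega))
    have hT := ErasureBC.slotsPerPacket_one_eq (K := K) hδ0 hδ1
    have hTpos := ErasureBC.slotsPerPacket_pos le_rfl hK hδ0 hδ1
    have hterm : ∀ i ∈ Finset.Icc 2 K,
        ((K.choose i : ℝ) * ErasureBC.packetsFromPhaseOne K δ N₁ i) /
          ErasureBC.sumCapacity F K i δ =
        N₁ / (1 - δ ^ K) *
          (δ ^ (K - i + 1) * (1 - δ) ^ (i - 1) * ErasureBC.slotsPerPacket K i δ) := by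
      intro i hi
      obtain ⟨hi1, hiK⟩ := Finset.mem_Icc.1 hi
      have h1 := (hC i hiK).ne'
      have h2 := (ErasureBC.slotsPerPacket_pos (by omega) hiK hδ0 hδ1).ne'
      rw [ErasureBC.sumCapacity_eq F (by omega) hiK hδ0 hδ1, ErasureBC.packetsFromPhaseOne,
        ErasureBC.phaseOneLength]
      field_simp
    have hsum : ∑ i ∈ Finset.Icc 2 K,
        δ ^ (K - i + 1) * (1 - δ) ^ (i - 1) * ErasureBC.slotsPerPacket K i δ =
        (1 - δ ^ K) * ErasureBC.slotsPerPacket K 1 δ - K := by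
      obtain ⟨k, rfl⟩ : ∃ k, K = k + 1 := ⟨K - 1, by omega⟩
      -- Isolates the term δ^K T_1, which joins the left-hand side to give (1 - δ^K) T_1.
      rw [Finset.sum_range_succ'] at hT
      have : ∑ i ∈ Finset.Icc 2 (k + 1), δ ^ (k + 1 - i + 1) * (1 - δ) ^ (i - 1) *
          ErasureBC.slotsPerPacket (k + 1) i δ = ∑ i ∈ Finset.range k,
          δ ^ (k + 1 - (i + 1)) * (1 - δ) ^ (i + 1) *
            ErasureBC.slotsPerPacket (k + 1) (i + 1 + 1) δ := by
        rw [← Finset.Ico_succ_right_eq_Icc, Finset.sum_Ico_eq_sum_range]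
        refine Finset.sum_congr (by simp) fun i hi => ?_
        have := Finset.mem_range.1 hi
        rw [show k + 1 - (2 + i) + 1 = k + 1 - (i + 1) by omega, show 2 + i - 1 = i + 1 by omega,
          show 2 + i = i + 1 + 1 by omega]
      rw [this]
      simp only [Nat.sub_zero, pow_zero, mul_one, zero_add] at hT
      linarith
    rw [Finset.sum_congr rfl hterm, ← Finset.mul_sum, hsum,
      ErasureBC.sumCapacity_eq F le_rfl hK hδ0 hδ1, Nat.choose_one_right]
    field_simp
    ring
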